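/- Let $\mathfrak g$ be a compact real Lie algebra of type $\mathrm F_4$ or $\mathrm E_8$ and let $B$ be the negative of its Killing form. Let $\theta,\tau$ be two commuting involutive automorphisms of $\mathfrak g$, let $\mathfrak k$ be the algebra of their common fixed points, and let $\mathfrak m_1,\mathfrak m_2,\mathfrak m_3$ be the joint eigenspaces of $(\theta,\tau)$ for the eigenvalues $(1,-1)$, $(-1,1)$, $(-1,-1)$, so that $\mathfrak g^\theta=\mathfrak k+\mathfrak m_1$ and $\mathfrak g^\tau=\mathfrak k+\mathfrak m_2$. Assume that each $\mathfrak m_i$ is an irreducible $\mathrm{ad}(\mathfrak k)$-module, that $\mathfrak k=\mathfrak k_1\oplus\mathfrak k_2\oplus\mathfrak k_3$ with $B$-orthogonal simple ideals $\mathfrak k_i$, and that $\mathfrak g^\tau=\mathfrak k_1\oplus\mathfrak b_2$ with ideals $\mathfrak k_1$ and $\mathfrak b_2=\mathfrak k_2+\mathfrak k_3+\mathfrak m_2$. The decomposition $$\mathfrak g=\mathfrak k_1\oplus\mathfrak k_2\oplus\mathfrak k_3\oplus\mathfrak m_1\oplus\mathfrak m_2\oplus\mathfrak m_3$$ is said to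 be * of type $\mathrm F_4$-II if $\mathfrak g$ is of type $\mathrm F_4$, $\mathfrak k_1\cong\mathfrak k_2\cong A_1$, $\mathfrak k_3\cong C_2$, $\mathfrak g^\theta\cong B_4$ and $\mathfrak b_2\cong C_3$; * of type $\mathrm E_8$-I if $\mathfrak g$ is of type $\mathrm E_8$, $\mathfrak k_1\cong\mathfrak k_2\cong A_1$, $\mathfrak k_3\cong D_6$, $\mathfrak g^\theta\cong D_8$ and $\mathfrak b_2\cong \mathrm E_7$ (all types being those of compact Lie algebras). Write $\mathfrak k_4=\mathfrak m_1$, $\mathfrak k_5=\mathfrak m_2$, $\mathfrak k_6=\mathfrak m_3$, choose a $B$-orthonormal basis $(e^i_\alpha)_\alpha$ of each $\mathfrak k_i$, $1\le i\le 6$, and put $$(ijk)=\sum_{\alpha,\beta,\gamma}B\big([e^i_\alpha,e^j_\beta],e^k_\gamma\big)^2 .$$ **Lemma.** For every choice of these bases the following holds. For type $\mathrm F_4$-II: $$(111)=(222)=\tfrac23,\quad (333)=\tfrac{10}3,\quad (144)=(244)=\tfrac53,\quad (155)=(266)=0,$$ $$(166)=(255)=\tfrac23,\quad (355)=(366)=\tfrac{10}9,\quad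 (344)=\tfrac{40}9,\quad (456)=\tfrac{20}9 .$$ For type $\mathrm E_8$-I: $$(111)=(222)=\tfrac15,\quad (333)=22,\quad (144)=(244)=\tfrac65,\quad (155)=(266)=0,$$ $$(166)=(255)=\tfrac85,\quad (344)=\tfrac{44}5,\quad (355)=(366)=\tfrac{88}5,\quad (456)=\tfrac{64}5 .$$ In both cases $(ijk)=0$ whenever $\{i,j,k\}$ is not, as a multiset, one of the index triples $111$, $222$, $333$, $144$, $155$, $166$, $244$, $255$, $266$, $344$, $355$, $366$, $456$. -/

import Mathlib

open scoped TensorProduct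

noncomputable section

/-- `L` is the compact real Lie algebra whose type is the Cartan matrix `A`: its Killing form is
negative definite, and the root system of its complexification, with respect to some Cartan
subalgebra and some base, has Cartan matrix `A` up to a relabelling of the simple roots.
(The entry `(i, j)` of the Cartan matrix of a base is the value of the `i`-th simple root on the
`j`-th simple coroot, which is the convention of `CartanMatrix.B` and `CartanMatrix.C`.) -/
def IsCompactOfType {n : ℕ} (A : Matrix (Fin n) (Fin n) ℤ)
    (L : Type*) [LieRing L] [LieAlgebra ℝ L] [FiniteDimensional ℝ L] : Prop :=
  (∀ x : L, x ≠ 0 → killingForm ℝ L x x < 0) ∧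
  ∃ (_ : LieAlgebra.IsKilling ℂ (ℂ ⊗[ℝ] L)) (H : LieSubalgebra ℂ (ℂ ⊗[ℝ] L))
    (_ : H.IsCartanSubalgebra) (b : (LieAlgebra.IsKilling.rootSystem H).Base)
    (e : b.support ≃ Fin n), ∀ i j : b.support, b.cartanMatrix i j = A (e i) (e j)

section Involutions

variable {g : Type*} [LieRing g] [LieAlgebra ℝ g]

/-- The subalgebra of fixed points of an automorphism. -/
def fixedSubalgebra (θ : g ≃ₗ⁅ℝ⁆ g) : LieSubalgebra ℝ g where
  carrier := {x | θ x = x}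
  add_mem' {x y} hx hy := by
    have hx' : θ x = x := hx
    have hy' : θ y = y := hy
    change θ (x + y) = x + y
    rw [map_add, hx', hy']
  zero_mem' := map_zero θ
  smul_mem' c x hx := by
    have hx' : θ x = x := hx
    change θ (c • x) = c • x
    rw [map_smul, hx']
  lie_mem' {x y} hx hy := by
    have hx' : θ x = x := hx
    have hy' : θ y = y := hy
    change θ ⁅x, y⁆ = ⁅x, y⁆
    rw [LieEquiv.map_lie, hx', hy']

/-- The `(-1)`-eigenspace of an automorphism. -/
def antiFixed (θ : g ≃ₗ⁅ℝ⁆ g) : Submodule ℝ g where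
  carrier := {x | θ x = -x}
  add_mem' {x y} hx hy := by
    have hx' : θ x = -x := hx
    have hy' : θ y = -y := hy
    change θ (x + y) = -(x + y)
    rw [map_add, hx', hy', neg_add]
  zero_mem' := by
    change θ 0 = -0
    rw [map_zero, neg_zero]
  smul_mem' c x hx := by
    have hx' : θ x = -x := hx
    change θ (c • x) = -(c • x)
    rw [map_smul, hx', smul_neg]

end Involutions

/-- The labels of the six summands `𝔨₁, 𝔨₂, 𝔨₃, 𝔪₁, 𝔪₂, 𝔪₃`; in the symbols `(ijk)` they are
numbered `1, 2, 3, 4, 5, 6` in this order. -/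
inductive Summand : Type
  | k₁ | k₂ | k₃ | m₁ | m₂ | m₃

/-- Two automorphisms `θ, τ` of `g`, three subalgebras `k₁, k₂, k₃` and one more subalgebra `b₂`.
Everything that is required of them is in `IsWallachTriple`. -/
structure WallachData (g : Type*) [LieRing g] [LieAlgebra ℝ g] where
  θ : g ≃ₗ⁅ℝ⁆ g
  τ : g ≃ₗ⁅ℝ⁆ g
  k₁ : LieSubalgebra ℝ g
  k₂ : LieSubalgebra ℝ g
  k₃ : LieSubalgebra ℝ g
  b₂ : LieSubalgebra ℝ g

namespace WallachData

variable {g : Type*} [LieRing g] [LieAlgebra ℝ g] (D : WallachData g)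

/-- The isotropy algebra `𝔨`, the common fixed points of `θ` and `τ`. -/
def k : LieSubalgebra ℝ g := fixedSubalgebra D.θ ⊓ fixedSubalgebra D.τ

/-- The six summands. `𝔪₁, 𝔪₂, 𝔪₃` are the joint eigenspaces of `(θ, τ)` for the eigenvalues
`(1, -1)`, `(-1, 1)`, `(-1, -1)`, so that the fixed algebra of `θ` is `𝔨 + 𝔪₁` and the one of `τ`
is `𝔨 + 𝔪₂`. -/
def summand : Summand → Submodule ℝ g
  | .k₁ => D.k₁.toSubmodule
  | .k₂ => D.k₂.toSubmodule
  | .k₃ => D.k₃.toSubmodule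
  | .m₁ => (fixedSubalgebra D.θ).toSubmodule ⊓ antiFixed D.τ
  | .m₂ => antiFixed D.θ ⊓ (fixedSubalgebra D.τ).toSubmodule
  | .m₃ => antiFixed D.θ ⊓ antiFixed D.τ

/-- `𝔞` is an ideal of the subalgebra `𝔥`. -/
def IsIdealOf (a h : LieSubalgebra ℝ g) : Prop :=
  a ≤ h ∧ ∀ x ∈ h, ∀ y ∈ a, ⁅x, y⁆ ∈ a

/-- `V` is a nonzero irreducible `ad 𝔥`-module. -/
def IsIrreducibleUnder (h : LieSubalgebra ℝ g) (V : Submodule ℝ g) : Prop :=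
  V ≠ ⊥ ∧ (∀ x ∈ h, ∀ v ∈ V, ⁅x, v⁆ ∈ V) ∧
    ∀ W : Submodule ℝ g, W ≤ V → (∀ x ∈ h, ∀ w ∈ W, ⁅x, w⁆ ∈ W) → W = ⊥ ∨ W = V

/-- The generalized Wallach decomposition `g = 𝔨₁ + 𝔨₂ + 𝔨₃ + 𝔪₁ + 𝔪₂ + 𝔪₃` given by two commuting
involutive automorphisms, orthogonal for the Killing form, in which `𝔨₁` and
`𝔟₂ = 𝔨₂ + 𝔨₃ + 𝔪₂` are ideals of the fixed algebra of `τ`. -/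
structure IsWallachTriple : Prop where
  θ_invol : ∀ x, D.θ (D.θ x) = x
  τ_invol : ∀ x, D.τ (D.τ x) = x
  comm : ∀ x, D.θ (D.τ x) = D.τ (D.θ x)
  k_eq : D.k.toSubmodule = D.k₁.toSubmodule ⊔ D.k₂.toSubmodule ⊔ D.k₃.toSubmodule
  ideal_k₁ : IsIdealOf D.k₁ D.k
  ideal_k₂ : IsIdealOf D.k₂ D.k
  ideal_k₃ : IsIdealOf D.k₃ D.k
  orthogonal : ∀ i j : Summand, i ≠ j → ∀ x ∈ D.summand i, ∀ y ∈ D.summand j,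
    killingForm ℝ g x y = 0
  irreducible_m₁ : IsIrreducibleUnder D.k (D.summand .m₁)
  irreducible_m₂ : IsIrreducibleUnder D.k (D.summand .m₂)
  irreducible_m₃ : IsIrreducibleUnder D.k (D.summand .m₃)
  b₂_eq : D.b₂.toSubmodule = D.k₂.toSubmodule ⊔ D.k₃.toSubmodule ⊔ D.summand .m₂
  ideal_k₁_fixed : IsIdealOf D.k₁ (fixedSubalgebra D.τ)
  ideal_b₂_fixed : IsIdealOf D.b₂ (fixedSubalgebra D.τ)

/-- The decomposition of type `F₄-II`: `g = F₄`, `𝔨 = A₁ + A₁ + C₂`, the fixed algebra of `θ`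
is `B₄` and the one of `τ` is `A₁ + C₃`. -/
structure IsF4II [FiniteDimensional ℝ g] : Prop extends D.IsWallachTriple where
  type_g : IsCompactOfType CartanMatrix.F₄ g
  type_k₁ : IsCompactOfType (CartanMatrix.A 1) D.k₁
  type_k₂ : IsCompactOfType (CartanMatrix.A 1) D.k₂
  type_k₃ : IsCompactOfType (CartanMatrix.C 2) D.k₃
  type_b : IsCompactOfType (CartanMatrix.B 4) (fixedSubalgebra D.θ)
  type_b₂ : IsCompactOfType (CartanMatrix.C 3) D.b₂

/-- The decomposition of type `E₈-I`: `g = E₈`, `𝔨 = A₁ + A₁ + D₆`, the fixed algebra of `θ`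
is `D₈` and the one of `τ` is `A₁ + E₇`. -/
structure IsE8I [FiniteDimensional ℝ g] : Prop extends D.IsWallachTriple where
  type_g : IsCompactOfType CartanMatrix.E₈ g
  type_k₁ : IsCompactOfType (CartanMatrix.A 1) D.k₁
  type_k₂ : IsCompactOfType (CartanMatrix.A 1) D.k₂
  type_k₃ : IsCompactOfType (CartanMatrix.D 6) D.k₃
  type_b : IsCompactOfType (CartanMatrix.D 8) (fixedSubalgebra D.θ)
  type_b₂ : IsCompactOfType CartanMatrix.E₇ D.b₂

/-- A basis of each summand, orthonormal for `B`, the negative of the Killing form. -/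
structure AdaptedBasis where
  e : (i : Summand) → Module.Basis (Fin (Module.finrank ℝ (D.summand i))) ℝ (D.summand i)
  orthonormal : ∀ i α β, -killingForm ℝ g (e i α : g) (e i β : g) = if α = β then 1 else 0

/-- The number `(ijk) = ∑ B([e_α, e_β], e_γ)²`, where `e_α`, `e_β`, `e_γ` run over the bases of the
`i`-th, `j`-th and `k`-th summand and `B` is the negative of the Killing form. -/
def AdaptedBasis.coeff {D : WallachData g} (E : D.AdaptedBasis) (i j k : Summand) : ℝ :=
  ∑ α, ∑ β, ∑ γ, (-killingForm ℝ g ⁅(E.e i α : g), (E.e j β : g)⁆ (E.e k γ : g)) ^ 2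

end WallachData

/-- The unordered triples of labels of the coefficients
`(111), (222), (333), (144), (155), (166), (244), (255), (266), (344), (355), (366), (456)`. -/
def listedTriples : Set (Multiset Summand) :=
  {{.k₁, .k₁, .k₁}, {.k₂, .k₂, .k₂}, {.k₃, .k₃, .k₃},
   {.k₁, .m₁, .m₁}, {.k₁, .m₂, .m₂}, {.k₁, .m₃, .m₃},
   {.k₂, .m₁, .m₁}, {.k₂, .m₂, .m₂}, {.k₂, .m₃, .m₃},
   {.k₃, .m₁, .m₁}, {.k₃, .m₂, .m₂}, {.k₃, .m₃, .m₃},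
   {.m₁, .m₂, .m₃}}

end

/-!
Write `dᵢ` for the dimension of the `i`-th summand. The expression of the Killing form as a trace turns
into `∑ (ijk) = dᵢ`, the sum over all `j`, `k`. If `𝔥` is a subalgebra of `g` that is spanned by some of
the summands and is simple, then its Killing form is proportional to the restriction of the Killing
form of `g`, by Schur's lemma, and the same computation in `𝔥` gives `∑ (ijk) = c * dᵢ` for the
summands of `𝔥`, with `j`, `k` in `𝔥` (`WallachData.AdaptedBasis.sum_coeff_top`,
`sum_coeff_fixedSubalgebra`, `sum_coeff_b₂`). This is applied to `g`, to `𝔤^θ` and to `𝔟₂`.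
The factors `c` need not be known: all `dᵢ` follow from the types of `g`, `𝔤^θ`, `𝔟₂` and the
`𝔨ᵢ`, and with `(155) = 0` the resulting linear equations determine both factors and leave a single
unknown, `(222)`.

That unknown is fixed by `(266) = 0`. The equations make `(266)` smaller than `(222)`. On the
other hand the Casimir operator of `𝔨₂`, which is a copy of `𝔰𝔲(2)`, acts on the irreducible module `𝔪₃`
as a scalar, which is that of some highest weight `n`; so `(266)` vanishes if `n = 0`, and is at
least `d₆ / 8 * (222) ≥ (222)` otherwise (`WallachData.AdaptedBasis.coeff_eq_zero_or_le`). The first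
alternative must hold.

Dimensions and simplicity are read off from the Cartan matrices. The positive roots of a root system
are generated from the simple ones by the simple reflections that increase the height, which is a
finite computation in coordinates (`RootPairing.Base.card_eq_two_mul_length_posRootList`); and a
connected Dynkin diagram makes the root system irreducible, hence the Lie algebra simple
(`IsCompactOfType.ideal_eq_bot_or_eq_top`). The remaining structure constants vanish by the grading
that `(θ, τ)` defines and because the `𝔨ᵢ` are ideals of `𝔨`.
-/

/-! ### Counting the roots of a root system from its Cartan matrix -/

namespace CartanMatrix

/-- The dot product of two lists of integers (the longer one is truncated). -/
def dot : List ℤ → List ℤ → ℤ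
  | a :: as, b :: bs => a * b + dot as bs
  | _, _ => 0

/-- The `j`-th column of a matrix, as a list. -/
def colList {n : ℕ} (A : Matrix (Fin n) (Fin n) ℤ) (j : Fin n) : List ℤ := List.ofFn fun i => A i j

/-- The reflection in the `j`-th simple root, on lists of coordinates with respect to the
simple roots. -/
def reflectList {n : ℕ} (A : Matrix (Fin n) (Fin n) ℤ) (j : Fin n) (c : List ℤ) : List ℤ :=
  c.modify j (fun x => x - dot c (colList A j))

/-- The coordinate list of the `j`-th simple root. -/
def simpleList (n : ℕ) (j : Fin n) : List ℤ := List.ofFn (Pi.single j 1 : Fin n → ℤ)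

/-- All the vectors obtained from those of `F` by a simple reflection that increases the height,
without repetition. -/
def raise {n : ℕ} (A : Matrix (Fin n) (Fin n) ℤ) (F : List (List ℤ)) : List (List ℤ) :=
  (F.flatMap fun c => ((List.finRange n).filter fun j => dot c (colList A j) < 0).map
    fun j => reflectList A j c).foldr List.insert []

/-- The concatenation of `F`, `raise A F`, …, with `k` terms. -/
def grow {n : ℕ} (A : Matrix (Fin n) (Fin n) ℤ) : ℕ → List (List ℤ) → List (List ℤ)
  | 0, _ => []
  | k + 1, F => F ++ grow A k (raise A F)

/-- The coordinate lists of the positive roots of depth at most `k`, computed from the Cartan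
matrix `A`. -/
def posRootList {n : ℕ} (A : Matrix (Fin n) (Fin n) ℤ) (k : ℕ) : List (List ℤ) :=
  grow A k ((List.finRange n).map (simpleList n))

lemma dot_ofFn {n : ℕ} (f g : Fin n → ℤ) : dot (List.ofFn f) (List.ofFn g) = ∑ i, f i * g i := by
  induction n with
  | zero => simp [dot]
  | succ n ih => simp [List.ofFn_succ, dot, ih, Fin.sum_univ_succ]

lemma reflectList_ofFn {n : ℕ} (A : Matrix (Fin n) (Fin n) ℤ) (j : Fin n) (f : Fin n → ℤ) :
    reflectList A j (List.ofFn f) = List.ofFn (f - Pi.single j (∑ l, f l * A l j)) := by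
  rw [reflectList, colList, dot_ofFn]
  apply List.ext_getElem (by simp)
  intro i h₁ h₂
  simp only [List.length_modify, List.length_ofFn] at h₁
  rw [List.getElem_modify]
  by_cases h : (j : ℕ) = i
  · subst h; simp
  · have : (⟨i, h₁⟩ : Fin n) ≠ j := fun h' => h (by simp [← h'])
    simp [h, this]

lemma mem_raise {n : ℕ} {A : Matrix (Fin n) (Fin n) ℤ} {F : List (List ℤ)} {d : List ℤ} :
    d ∈ raise A F ↔ ∃ c ∈ F, ∃ j, dot c (colList A j) < 0 ∧ reflectList A j c = d := by
  have aux (l : List (List ℤ)) : d ∈ l.foldr List.insert [] ↔ d ∈ l := by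
    induction l with
    | nil => simp
    | cons a l ih => simp [ih]
  rw [raise, aux]
  simp

lemma forall_mem_grow {n : ℕ} {A : Matrix (Fin n) (Fin n) ℤ} (p : List ℤ → Prop)
    (hp : ∀ c, p c → ∀ j, dot c (colList A j) < 0 → p (reflectList A j c)) (k : ℕ)
    {F : List (List ℤ)} (hF : ∀ c ∈ F, p c) : ∀ c ∈ grow A k F, p c := by
  induction k generalizing F with
  | zero => simp [grow]
  | succ k ih =>
    simp only [grow, List.mem_append]
    rintro c (hc | hc)
    · exact hF c hc
    · refine ih (fun d hd => ?_) c hc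
      obtain ⟨c', hc', j, hj, rfl⟩ := mem_raise.1 hd
      exact hp c' (hF c' hc') j hj

/-- If the process stops within `k` steps, its result is closed under the simple reflections that
increase the height. -/
lemma reflectList_mem_grow {n : ℕ} {A : Matrix (Fin n) (Fin n) ℤ} (k : ℕ) {F : List (List ℤ)}
    (hF : (raise A)^[k] F = []) {c : List ℤ} (hc : c ∈ grow A k F) {j : Fin n}
    (hj : dot c (colList A j) < 0) : reflectList A j c ∈ grow A k F := by
  induction k generalizing F with
  | zero => simp [grow] at hc
  | succ k ih =>
    simp only [grow, List.mem_append] at hc ⊢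
    rw [Function.iterate_succ_apply] at hF
    right
    rcases hc with hc | hc
    · have hm : reflectList A j c ∈ raise A F := mem_raise.2 ⟨c, hc, j, hj, rfl⟩
      cases k with
      | zero => simp_all
      | succ k => simp [grow, hm]
    · exact ih hF hc

end CartanMatrix

namespace RootPairing.Base

open CartanMatrix

set_option linter.unusedSectionVars false

variable {ι K M N : Type*} [Finite ι] [Field K] [CharZero K] [AddCommGroup M] [Module K M]
  [AddCommGroup N] [Module K N] {P : RootPairing ι K M N} [P.IsRootSystem] [P.IsCrystallographic]
  [P.IsReduced] (b : P.Base) {n : ℕ} (e : b.support ≃ Fin n)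

/-- The vector with given integral coordinates with respect to the simple roots. -/
def ofCoord (f : Fin n → ℤ) : M := ∑ l, f l • P.root (e.symm l)

lemma ofCoord_injective : Function.Injective (b.ofCoord e) := by
  intro f g h
  have h1 : LinearIndependent ℤ fun l : Fin n => P.root (e.symm l) :=
    (b.linearIndepOn_root.restrict_scalars' ℤ).comp e.symm e.symm.injective
  exact funext fun l => Fintype.linearIndependent_iffₛ.mp h1 f g h l

lemma ofCoord_single (j : Fin n) : b.ofCoord e (Pi.single j 1) = P.root (e.symm j) := by
  rw [ofCoord, Finset.sum_eq_single j] <;> simp +contextual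

variable {A : Matrix (Fin n) (Fin n) ℤ} (hA : ∀ i j : b.support, b.cartanMatrix i j = A (e i) (e j))

include hA in
lemma coroot'_ofCoord (f : Fin n → ℤ) (j : Fin n) :
    P.coroot' (e.symm j) (b.ofCoord e f) = ((∑ l, f l * A l j : ℤ) : K) := by
  simp only [ofCoord, map_sum, map_zsmul, Int.cast_sum, Int.cast_mul]
  refine Finset.sum_congr rfl fun l _ => ?_
  have := hA (e.symm l) (e.symm j)
  rw [Equiv.apply_symm_apply, Equiv.apply_symm_apply] at this
  rw [← this, cartanMatrix, cartanMatrixIn_def, root_coroot'_eq_pairing, zsmul_eq_mul,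
    ← P.algebraMap_pairingIn ℤ, eq_intCast]

include hA in
lemma ofCoord_reflect (f : Fin n → ℤ) (j : Fin n) :
    b.ofCoord e (f - Pi.single j (∑ l, f l * A l j)) =
      P.reflection (e.symm j) (b.ofCoord e f) := by
  rw [reflection_apply, coroot'_ofCoord b e hA, Int.cast_smul_eq_zsmul]
  simp only [ofCoord, Pi.sub_apply, sub_smul, Finset.sum_sub_distrib]
  congr 1
  rw [Finset.sum_eq_single j] <;> simp +contextual

lemma height_eq_sum_coord {i : ι} {f : Fin n → ℤ} (h : P.root i = b.ofCoord e f) :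
    b.height i = ∑ l, f l := by
  classical
  let f' : ι → ℤ := fun j => if hj : j ∈ b.support then f (e ⟨j, hj⟩) else 0
  have hf' (l : Fin n) : f' (e.symm l) = f l := by simp [f']
  rw [b.height_eq_sum (f := f')]
  · rw [← Finset.sum_coe_sort, ← e.symm.sum_comp]
    exact Finset.sum_congr rfl fun l _ => hf' l
  · rw [h, ofCoord, ← b.support.sum_coe_sort fun j => f' j • P.root j, ← e.symm.sum_comp]
    exact Finset.sum_congr rfl fun l _ => by rw [hf']

lemma exists_eq_ofCoord (i : ι) : ∃ f, P.root i = b.ofCoord e f := by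
  obtain ⟨f, -, -, hf⟩ := b.exists_root_eq_sum_int i
  refine ⟨fun l => f (e.symm l), ?_⟩
  rw [hf, ofCoord, ← Finset.sum_coe_sort, ← e.symm.sum_comp]

include hA in
/-- Every positive root is obtained from a simple one by simple reflections that increase the
height. -/
lemma IsPos.mem_posRootList {k : ℕ}
    (hk : (raise A)^[k] ((List.finRange n).map (simpleList n)) = []) {i : ι} (hi : b.IsPos i)
    {f : Fin n → ℤ} (hf : P.root i = b.ofCoord e f) : List.ofFn f ∈ posRootList A k := by
  generalize hN : (b.height i).natAbs = N
  induction N using Nat.strongRecOn generalizing i f with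
  | ind N ih =>
    obtain ⟨j, hj, hj'⟩ := hi.exists_mem_support_pos_pairingIn
    rw [P.zero_lt_pairingIn_iff'] at hj'
    obtain ⟨j, rfl⟩ : ∃ l : Fin n, (e.symm l : ι) = j := ⟨e ⟨j, hj⟩, by simp⟩
    rcases eq_or_ne i (e.symm j) with rfl | hij
    · rw [← ofCoord_single b e] at hf
      rw [← ofCoord_injective b e hf]
      cases k with
      | zero =>
        rw [Function.iterate_zero_apply, List.map_eq_nil_iff] at hk
        exact absurd (List.mem_finRange j) (by simp [hk])
      | succ k =>
        exact List.mem_append_left _ (List.mem_map.2 ⟨j, List.mem_finRange j, rfl⟩)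
    have hpos := hi.reflectionPerm hj hij
    have hm : P.pairingIn ℤ i (e.symm j) = ∑ l, f l * A l j := by
      have h := coroot'_ofCoord b e hA f j
      rw [← hf, root_coroot'_eq_pairing, ← P.algebraMap_pairingIn ℤ, eq_intCast] at h
      exact_mod_cast h
    set m := ∑ l, f l * A l j with hm_def
    have hs : P.root (P.reflectionPerm (e.symm j) i) = b.ofCoord e (f - Pi.single j m) := by
      rw [root_reflectionPerm, hf, ofCoord_reflect b e hA]
    have hht : b.height (P.reflectionPerm (e.symm j) i) = b.height i - m := by
      rw [height_eq_sum_coord b e hs, height_eq_sum_coord b e hf]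
      simp [Finset.sum_sub_distrib]
    have hlt : (b.height (P.reflectionPerm (e.symm j) i)).natAbs < N := by
      rw [isPos_iff] at hpos hi
      omega
    have hmem := ih _ hlt hpos hs rfl
    have hm' : ∑ l, (f - Pi.single j m : Fin n → ℤ) l * A l j = -m := by
      have hjj : A j j = 2 := by
        have := hA (e.symm j) (e.symm j)
        rw [Equiv.apply_symm_apply] at this
        rw [← this]; exact b.cartanMatrix_apply_same _
      simp only [Pi.sub_apply, sub_mul, Finset.sum_sub_distrib]
      rw [Finset.sum_eq_single (f := fun l => (Pi.single j m : Fin n → ℤ) l * A l j) j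
        (by simp +contextual) (by simp), Pi.single_eq_same, hjj, ← hm_def]
      ring
    have hres := reflectList_mem_grow k hk hmem (j := j)
      (by rw [colList, dot_ofFn, hm']; omega)
    rw [reflectList_ofFn, hm'] at hres
    convert! hres using 2
    ext l
    by_cases h : l = j <;> simp [h]

include hA in
lemma exists_isPos_of_mem_posRootList {k : ℕ} {c : List ℤ} (hc : c ∈ posRootList A k) :
    ∃ f i, c = List.ofFn f ∧ b.IsPos i ∧ P.root i = b.ofCoord e f := by
  suffices ∃ f i, c = List.ofFn f ∧ 0 ≤ f ∧ P.root i = b.ofCoord e f by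
    obtain ⟨f, i, h₁, h₂, h₃⟩ := this
    refine ⟨f, i, h₁, ?_, h₃⟩
    rw [isPos_iff', height_eq_sum_coord b e h₃]
    exact Finset.sum_nonneg fun l _ => h₂ l
  refine forall_mem_grow (A := A) (fun c => ∃ f i, c = List.ofFn f ∧ 0 ≤ f ∧
    P.root i = b.ofCoord e f) ?_ k ?_ c hc
  · rintro _ ⟨f, i, rfl, hf, hi⟩ j hj
    rw [colList, dot_ofFn] at hj
    refine ⟨f - Pi.single j (∑ l, f l * A l j), P.reflectionPerm (e.symm j) i,
      reflectList_ofFn A j f, ?_, ?_⟩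
    · have : Pi.single j (∑ l, f l * A l j) ≤ (0 : Fin n → ℤ) := by
        rw [← Pi.single_zero j]; exact Pi.single_mono j hj.le
      exact sub_nonneg.2 (this.trans hf)
    · rw [root_reflectionPerm, hi, ofCoord_reflect b e hA]
  · simp only [List.mem_map, List.mem_finRange, true_and]
    rintro _ ⟨j, rfl⟩
    exact ⟨Pi.single j 1, e.symm j, rfl, Pi.single_nonneg.2 zero_le_one,
      (ofCoord_single b e j).symm⟩

include hA in
/-- The number of roots, computed from the Cartan matrix. -/
theorem card_eq_two_mul_length_posRootList (k : ℕ)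
    (hk : (raise A)^[k] ((List.finRange n).map (simpleList n)) = [])
    (hnodup : (posRootList A k).Nodup) : Nat.card ι = 2 * (posRootList A k).length := by
  classical
  let := P.indexNeg
  have := Fintype.ofFinite ι
  have hneg : Fintype.card {i // ¬ b.IsPos i} = Fintype.card {i // b.IsPos i} :=
    Fintype.card_congr
      { toFun := fun i => ⟨-i.1, (IsPos.neg_iff_not b i.1).2 i.2⟩
        invFun := fun i => ⟨-i.1, by rw [← IsPos.neg_iff_not, neg_neg]; exact i.2⟩
        left_inv := fun i => Subtype.ext (neg_neg i.1)
        right_inv := fun i => Subtype.ext (neg_neg i.1) }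
  have hpos : Fintype.card {i // b.IsPos i} = (posRootList A k).length := by
    rw [← List.toFinset_card_of_nodup hnodup, ← Fintype.card_coe]
    choose f hf using b.exists_eq_ofCoord e
    refine Fintype.card_of_bijective (f := fun i : {i // b.IsPos i} =>
      (⟨List.ofFn (f i), List.mem_toFinset.2 (IsPos.mem_posRootList b e hA hk i.2 (hf i))⟩ :
        (posRootList A k).toFinset)) ⟨fun i j hij => ?_, fun ⟨c, hc⟩ => ?_⟩
    · have h : f i = f j := List.ofFn_injective (Subtype.ext_iff.1 hij)
      exact Subtype.ext (P.root.injective (by rw [hf, hf, h]))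
    · obtain ⟨g, i, rfl, hi, hg⟩ := exists_isPos_of_mem_posRootList b e hA (List.mem_toFinset.1 hc)
      exact ⟨⟨i, hi⟩, Subtype.ext (congrArg List.ofFn
        (ofCoord_injective b e ((hf i).symm.trans hg)))⟩
  have hle := Fintype.card_subtype_le b.IsPos
  rw [Fintype.card_subtype_compl] at hneg
  rw [Nat.card_eq_fintype_card, ← hpos]
  omega

end RootPairing.Base

/-! ### Irreducibility from a connected Dynkin diagram -/

namespace CartanMatrix

/-- The Dynkin diagram of the Cartan matrix `A` is connected: a set of nodes that contains, with
a node, all its neighbours is empty or everything. -/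
def IsConnected {n : ℕ} (A : Matrix (Fin n) (Fin n) ℤ) : Prop :=
  ∀ p : Fin n → Prop, (∃ i, p i) → (∀ i j, p i → A j i ≠ 0 → p j) → ∀ i, p i

/-- A diagram is connected if it has a spanning tree: `t i` is the parent of the node `i` in a tree
with root `i₀`, and `r i` is the depth of `i`. -/
lemma isConnected_of_tree {n : ℕ} {A : Matrix (Fin n) (Fin n) ℤ} (r : Fin n → ℕ)
    (t : Fin n → Fin n) (i₀ : Fin n)
    (h : ∀ i, i ≠ i₀ → r (t i) < r i ∧ A i (t i) ≠ 0 ∧ A (t i) i ≠ 0) : IsConnected A := by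
  rintro p ⟨i, hi⟩ hp
  have h₀ : p i₀ := by
    induction hN : r i using Nat.strongRecOn generalizing i with
    | ind N ih =>
      rcases eq_or_ne i i₀ with rfl | hne
      · exact hi
      · obtain ⟨hlt, -, hA⟩ := h i hne
        exact ih _ (hN ▸ hlt) (t i) (hp i _ hi hA) rfl
  intro j
  induction hN : r j using Nat.strongRecOn generalizing j with
  | ind N ih =>
    rcases eq_or_ne j i₀ with rfl | hne
    · exact h₀
    · obtain ⟨hlt, hA, -⟩ := h j hne
      exact hp _ j (ih _ (hN ▸ hlt) (t j) rfl) hA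

end CartanMatrix

open CartanMatrix in
/-- A root system with a connected Dynkin diagram is irreducible. -/
theorem RootPairing.Base.isIrreducible_of_isConnected {ι K M N : Type*} [Finite ι] [Field K]
    [CharZero K] [AddCommGroup M] [Module K M] [AddCommGroup N] [Module K N]
    {P : RootPairing ι K M N} [P.IsRootSystem] [P.IsCrystallographic] [P.IsReduced] [Nontrivial M]
    (b : P.Base) {n : ℕ} (e : b.support ≃ Fin n) {A : Matrix (Fin n) (Fin n) ℤ}
    (hA : ∀ i j : b.support, b.cartanMatrix i j = A (e i) (e j)) (hconn : IsConnected A) :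
    P.IsIrreducible := by
  refine RootPairing.IsIrreducible.mk' P fun q hq hq₀ => ?_
  -- a coroot not vanishing on `q` has its root in `q`
  have key (i : ι) {v : M} (hv : v ∈ q) (h : P.coroot' i v ≠ 0) : P.root i ∈ q := by
    have h₁ : P.reflection i v ∈ q := hq i hv
    rw [reflection_apply] at h₁
    have h₂ : P.coroot' i v • P.root i ∈ q := by
      simpa using q.sub_mem hv h₁
    exact (q.smul_mem_iff h).1 h₂
  have hall : ∀ l, P.root (e.symm l) ∈ q := by
    refine hconn (fun l => P.root (e.symm l) ∈ q) ?_ ?_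
    · obtain ⟨v, hv, hv₀⟩ := q.ne_bot_iff.1 hq₀
      by_contra! hcon
      refine hv₀ (P.toPerfPair.injective ?_)
      rw [map_zero]
      refine b.toCoweightBasis.ext fun i => ?_
      have h := mt (key i hv) (by simpa using hcon (e i))
      rw [not_not] at h
      simpa using h
    · intro i j hi hji
      refine key _ hi ?_
      have := hA (e.symm j) (e.symm i)
      rw [Equiv.apply_symm_apply, Equiv.apply_symm_apply] at this
      rw [← this, Ne, b.cartanMatrix_apply_eq_zero_iff_symm,
        b.cartanMatrix_apply_eq_zero_iff_pairing] at hji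
      rwa [root_coroot'_eq_pairing]
  rw [eq_top_iff, ← b.toWeightBasis.span_eq, Submodule.span_le]
  rintro _ ⟨i, rfl⟩
  simpa using hall (e i)

/-! ### Dimension and ideals of a compact Lie algebra of given type -/

namespace LieAlgebra.IsKilling

open LieModule Module

variable {K L : Type*} [Field K] [CharZero K] [LieRing L] [LieAlgebra K L] [FiniteDimensional K L]
  [IsKilling K L] {H : LieSubalgebra K L} [H.IsCartanSubalgebra] [IsTriangularizable K H L]

/-- The dimension formula given by the root space decomposition. -/
theorem finrank_eq_finrank_add_card_root [Nontrivial L] :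
    finrank K L = finrank K H + Nat.card H.root := by
  classical
  have hint : DirectSum.IsInternal fun χ : Weight K H L => (rootSpace H χ).toSubmodule := by
    rw [DirectSum.isInternal_submodule_iff_iSupIndep_and_iSup_eq_top,
      LieSubmodule.iSupIndep_toSubmodule, ← LieSubmodule.iSup_toSubmodule]
    exact ⟨iSupIndep_genWeightSpace' K H L, by rw [iSup_genWeightSpace_eq_top']; rfl⟩
  rw [← (LinearEquiv.ofBijective (DirectSum.coeLinearMap _) hint).finrank_eq, finrank_directSum,
    ← Finset.add_sum_erase _ _ (Finset.mem_univ (0 : Weight K H L))]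
  congr 1
  · have : rootSpace H ((0 : Weight K H L) : H → K) = H.toLieSubmodule := by
      rw [FunLike.coe_zero, rootSpace_zero_eq]
    rw [this]; rfl
  · have he : Finset.univ.erase (0 : Weight K H L) = H.root := by
      ext χ
      simp [LieSubalgebra.root, Weight.IsNonZero, Weight.isZero_iff_eq_zero]
    rw [he, Finset.sum_congr rfl (g := fun _ => 1), Finset.sum_const, smul_eq_mul, mul_one]
    · exact (Nat.card_eq_finsetCard _).symm
    · intro χ hχ
      exact finrank_rootSpace_eq_one χ (by simpa [LieSubalgebra.root] using hχ)

end LieAlgebra.IsKilling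

namespace IsCompactOfType

open Module CartanMatrix

variable {n : ℕ} {A : Matrix (Fin n) (Fin n) ℤ} {L : Type*} [LieRing L] [LieAlgebra ℝ L]
  [FiniteDimensional ℝ L]

/-- The dimension of a compact Lie algebra of given type is its rank plus twice the number of positive
roots. -/
theorem finrank_eq (h : IsCompactOfType A L) (hn : 0 < n) (k : ℕ)
    (hk : (raise A)^[k] ((List.finRange n).map (simpleList n)) = [])
    (hnodup : (posRootList A k).Nodup) :
    finrank ℝ L = n + 2 * (posRootList A k).length := by
  obtain ⟨-, hK, H, hH, b, e, hb⟩ := h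
  have : Nontrivial (ℂ ⊗[ℝ] L) := by
    by_contra hc
    rw [not_nontrivial_iff_subsingleton] at hc
    exact (e.symm ⟨0, hn⟩).1.1.genWeightSpace_ne_bot _ (Subsingleton.elim _ _)
  rw [← finrank_baseChange (R := ℂ), LieAlgebra.IsKilling.finrank_eq_finrank_add_card_root (H := H),
    b.card_eq_two_mul_length_posRootList e hb k hk hnodup, ← Subspace.dual_finrank_eq,
    finrank_eq_card_basis b.toWeightBasis, Fintype.card_congr e, Fintype.card_fin]

/-- A compact Lie algebra with a connected Dynkin diagram has no proper ideals. -/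
theorem ideal_eq_bot_or_eq_top (h : IsCompactOfType A L) (hn : 0 < n)
    (hconn : IsConnected A) (I : LieIdeal ℝ L) : I = ⊥ ∨ I = ⊤ := by
  obtain ⟨-, hK, H, hH, b, e, hb⟩ := h
  have : Nontrivial (Dual ℂ H) :=
    nontrivial_of_ne _ _ ((LieAlgebra.IsKilling.rootSystem H).ne_zero (e.symm ⟨0, hn⟩).1)
  have hirr := b.isIrreducible_of_isConnected e hb hconn
  have hsimple := LieAlgebra.IsKilling.isSimple_iff_isIrreducible.1 hirr
  have hinj : Function.Injective (LieSubmodule.baseChange (R := ℝ) (L := L) (M := L) ℂ) := by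
    intro I J hIJ
    refine LieSubmodule.toSubmodule_injective (Submodule.baseChange_injective (A := ℂ) ?_)
    exact congrArg LieSubmodule.toSubmodule hIJ
  refine (hsimple.eq_bot_or_eq_top (I.baseChange ℂ)).imp (fun hI => hinj ?_) (fun hI => hinj ?_)
  · rw [hI, LieSubmodule.baseChange_bot]
  · rw [hI, LieSubmodule.baseChange_top]

end IsCompactOfType

/-! ### The types that occur: dimensions and connectedness -/

-- In each case the number of steps is `h - 1`, with `h` the Coxeter number: this is the height of the
-- highest root, and every step of `raise` increases the height.
namespace IsCompactOfType

open Module CartanMatrix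

variable {L : Type*} [LieRing L] [LieAlgebra ℝ L] [FiniteDimensional ℝ L]

theorem finrank_A_one (h : IsCompactOfType (A 1) L) : finrank ℝ L = 3 := by
  rw [h.finrank_eq one_pos 1 (by decide +kernel) (by decide +kernel),
    show (posRootList (A 1) 1).length = 1 by decide +kernel]

theorem finrank_C_two (h : IsCompactOfType (C 2) L) : finrank ℝ L = 10 := by
  rw [h.finrank_eq two_pos 3 (by decide +kernel) (by decide +kernel),
    show (posRootList (C 2) 3).length = 4 by decide +kernel]

theorem finrank_C_three (h : IsCompactOfType (C 3) L) : finrank ℝ L = 21 := by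
  rw [h.finrank_eq three_pos 5 (by decide +kernel) (by decide +kernel),
    show (posRootList (C 3) 5).length = 9 by decide +kernel]

theorem finrank_B_four (h : IsCompactOfType (B 4) L) : finrank ℝ L = 36 := by
  rw [h.finrank_eq four_pos 7 (by decide +kernel) (by decide +kernel),
    show (posRootList (B 4) 7).length = 16 by decide +kernel]

theorem finrank_D_six (h : IsCompactOfType (D 6) L) : finrank ℝ L = 66 := by
  rw [h.finrank_eq (by norm_num) 9 (by decide +kernel) (by decide +kernel),
    show (posRootList (D 6) 9).length = 30 by decide +kernel]

theorem finrank_D_eight (h : IsCompactOfType (D 8) L) : finrank ℝ L = 120 := by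
  rw [h.finrank_eq (by norm_num) 13 (by decide +kernel) (by decide +kernel),
    show (posRootList (D 8) 13).length = 56 by decide +kernel]

theorem finrank_F_four (h : IsCompactOfType F₄ L) : finrank ℝ L = 52 := by
  rw [h.finrank_eq four_pos 11 (by decide +kernel) (by decide +kernel),
    show (posRootList F₄ 11).length = 24 by decide +kernel]

theorem finrank_E_seven (h : IsCompactOfType E₇ L) : finrank ℝ L = 133 := by
  rw [h.finrank_eq (by norm_num) 17 (by decide +kernel) (by decide +kernel),
    show (posRootList E₇ 17).length = 63 by decide +kernel]

theorem finrank_E_eight (h : IsCompactOfType E₈ L) : finrank ℝ L = 248 := by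
  rw [h.finrank_eq (by norm_num) 29 (by decide +kernel) (by decide +kernel),
    show (posRootList E₈ 29).length = 120 by decide +kernel]

end IsCompactOfType

namespace CartanMatrix

lemma isConnected_B_four : IsConnected (B 4) :=
  isConnected_of_tree (fun i => i) ![0, 0, 1, 2] 0 (by decide +kernel)

lemma isConnected_C_three : IsConnected (C 3) :=
  isConnected_of_tree (fun i => i) ![0, 0, 1] 0 (by decide +kernel)

lemma isConnected_D_eight : IsConnected (D 8) :=
  isConnected_of_tree (fun i => i) ![0, 0, 1, 2, 3, 4, 5, 5] 0 (by decide +kernel)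

lemma isConnected_E_seven : IsConnected E₇ :=
  isConnected_of_tree ![0, 3, 1, 2, 3, 4, 5] ![0, 3, 0, 2, 3, 4, 5] 0 (by decide +kernel)

end CartanMatrix

/-! ### Orthonormal bases of a bilinear form and invariant forms -/

namespace LinearMap.BilinForm

open Module

variable {V ι : Type*} [AddCommGroup V] [Module ℝ V] [Fintype ι] [DecidableEq ι]
  {B : LinearMap.BilinForm ℝ V} {b : Basis ι ℝ V}
  (hb : ∀ i j, B (b i) (b j) = if i = j then 1 else 0)

include hb

lemma repr_eq_of_orthonormal (v : V) (i : ι) : b.repr v i = B (b i) v := by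
  conv_rhs => rw [← b.sum_repr v]
  simp [hb, -Basis.sum_repr]

lemma sum_sq_of_orthonormal (v : V) : B v v = ∑ i, B v (b i) ^ 2 := by
  have h (i : ι) : B v (b i) = b.repr v i := by
    conv_lhs => rw [← b.sum_repr v]
    simp [hb, -Basis.sum_repr]
  simp_rw [h]
  conv_lhs => rw [← b.sum_repr v]
  simp [hb, sq, -Basis.sum_repr]

lemma trace_eq_of_orthonormal (T : V →ₗ[ℝ] V) : LinearMap.trace ℝ V T = ∑ i, B (b i) (T (b i)) := by
  rw [LinearMap.trace_eq_matrix_trace ℝ b, Matrix.trace]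
  simp [LinearMap.toMatrix_apply, repr_eq_of_orthonormal hb]

/-- The spectral theorem for two forms: a symmetric form has an eigenvector with respect to a form
that admits an orthonormal basis. -/
lemma exists_eigenvector_of_orthonormal [Nontrivial V] {C : LinearMap.BilinForm ℝ V}
    (hC : ∀ v w, C v w = C w v) : ∃ (c : ℝ) (v : V), v ≠ 0 ∧ ∀ w, C v w = c * B v w := by
  let M : Matrix ι ι ℝ := Matrix.of fun i j => C (b i) (b j)
  have hM : M.IsHermitian := Matrix.IsHermitian.ext fun i j => by simp [M, hC (b i)]
  obtain ⟨i₀⟩ : Nonempty ι := b.index_nonempty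
  set u := (hM.eigenvectorBasis i₀ : ι → ℝ)
  have hu : M.mulVec u = hM.eigenvalues i₀ • u := hM.mulVec_eigenvectorBasis i₀
  have hu₀ : u ≠ 0 := fun h => hM.eigenvectorBasis.toBasis.ne_zero i₀ (by
    rw [OrthonormalBasis.coe_toBasis]; ext i; exact congrFun h i)
  refine ⟨hM.eigenvalues i₀, b.equivFun.symm u,
    by simpa [-Basis.equivFun_symm_apply] using hu₀, fun w => ?_⟩
  suffices C (b.equivFun.symm u) = hM.eigenvalues i₀ • B (b.equivFun.symm u) by
    rw [this]; rfl
  refine b.ext fun j => ?_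
  have := congrFun hu j
  rw [Matrix.mulVec, dotProduct] at this
  simp only [b.equivFun_symm_apply, map_sum, map_smul, LinearMap.sum_apply, LinearMap.smul_apply,
    hb, smul_eq_mul] at this ⊢
  rw [Finset.sum_congr rfl fun i _ => by rw [mul_comm]]
  simpa [M, hC (b j)] using this

/-- Schur's lemma for forms: on a space without proper subspaces that are invariant under a set of
operators, two symmetric forms for which all these operators are skew are proportional. -/
lemma exists_eq_smul_of_irreducible [Nontrivial V] {C : LinearMap.BilinForm ℝ V}
    (hC : ∀ v w, C v w = C w v) (S : Set (V →ₗ[ℝ] V))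
    (hSB : ∀ s ∈ S, ∀ v w, B (s v) w = -B v (s w)) (hSC : ∀ s ∈ S, ∀ v w, C (s v) w = -C v (s w))
    (hS : ∀ W : Submodule ℝ V, (∀ s ∈ S, ∀ v ∈ W, s v ∈ W) → W = ⊥ ∨ W = ⊤) :
    ∃ c : ℝ, ∀ v w, C v w = c * B v w := by
  obtain ⟨c, v, hv₀, hv⟩ := exists_eigenvector_of_orthonormal hb hC
  refine ⟨c, ?_⟩
  let W : Submodule ℝ V := LinearMap.ker (C - c • B)
  have hmem (x : V) : x ∈ W ↔ ∀ w, C x w = c * B x w := by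
    simp [W, LinearMap.ext_iff, sub_eq_zero]
  have hW := hS W fun s hs x hx => (hmem _).2 fun w => by
    rw [hSC s hs, hSB s hs, (hmem x).1 hx]; ring
  rcases hW with hW | hW
  · exact absurd ((Submodule.mem_bot ℝ).1 (hW ▸ (hmem v).2 hv)) hv₀
  · exact fun v => (hmem v).1 (hW ▸ Submodule.mem_top)

end LinearMap.BilinForm

/-! ### The Casimir operator of `𝔰𝔲(2)` -/

namespace Module.End

attribute [local instance] LieRing.ofAssociativeRing

lemma exists_hasPrimitiveVectorWith {W : Type*} [AddCommGroup W] [Module ℂ W]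
    [FiniteDimensional ℂ W] [Nontrivial W] {h e f : Module.End ℂ W} (t : IsSl2Triple h e f) :
    ∃ (m : W) (μ : ℂ), t.HasPrimitiveVectorWith m μ := by
  obtain ⟨μ₀, hμ₀⟩ := Module.End.exists_eigenvalue h
  have hfin : (Set.ofPred h.HasEigenvalue).Finite := Module.End.finite_hasEigenvalue h
  obtain ⟨μ, hμ, hmax⟩ := hfin.exists_maximalFor Complex.re _ ⟨μ₀, hμ₀⟩
  obtain ⟨m, hm⟩ := Module.End.HasEigenvalue.exists_hasEigenvector hμ
  refine ⟨m, μ, hm.2, hm.apply_eq_smul, ?_⟩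
  by_contra he
  have hle : h ⁅e, m⁆ = (μ + 2) • ⁅e, m⁆ := by
    have h₁ : ⁅h, ⁅e, m⁆⁆ = ⁅⁅h, e⁆, m⁆ + ⁅e, ⁅h, m⁆⁆ := by rw [leibniz_lie]
    have h₂ : ⁅h, m⁆ = μ • m := hm.apply_eq_smul
    rw [t.lie_h_e_nsmul, nsmul_lie, h₂, lie_smul] at h₁
    exact h₁.trans (by module)
  have hev : h.HasEigenvalue (μ + 2) :=
    Module.End.hasEigenvalue_of_hasEigenvector ⟨Module.End.mem_eigenspace_iff.2 hle, he⟩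
  have := hmax hev (by simp)
  norm_num at this

/-- If the real operators `X`, `Y`, `Z` satisfy the relations of an orthogonal basis of `𝔰𝔲(2)` and
`X² + Y² + Z²` is a scalar, this scalar is the value of the Casimir operator on the representation
with highest weight `n`. -/
theorem exists_casimir_eq {V : Type*} [AddCommGroup V] [Module ℝ V] [FiniteDimensional ℝ V]
    [Nontrivial V] {X Y Z : Module.End ℝ V} {μ c : ℝ} (hμ : μ ≠ 0)
    (hXY : X * Y - Y * X = μ • Z) (hYZ : Y * Z - Z * Y = μ • X) (hZX : Z * X - X * Z = μ • Y)
    (hc : X * X + Y * Y + Z * Z = -c • 1) : ∃ n : ℕ, c = μ ^ 2 * (n * (n + 2) / 4) := by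
  by_cases hX : X = 0
  · subst hX
    have hZ : Z = 0 := by simpa [hμ] using hXY.symm
    have hY : Y = 0 := by simpa [hμ] using hZX.symm
    refine ⟨0, ?_⟩
    simpa [hY, hZ] using hc.symm
  let φ : Module.End ℝ V →ₐ[ℝ] Module.End ℂ (ℂ ⊗[ℝ] V) := Module.End.baseChangeHom ℝ ℂ V
  have hφ : Function.Injective φ := LinearMap.baseChangeHom_injective ℝ V ℂ
  have hφs (r : ℝ) (T : Module.End ℝ V) : φ (r • T) = (r : ℂ) • φ T := by
    rw [map_smul]; exact (algebraMap_smul ℂ r (φ T)).symm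
  set x := φ (μ⁻¹ • X) with hx
  set y := φ (μ⁻¹ • Y) with hy
  set z := φ (μ⁻¹ • Z) with hz
  have hrel {X Y Z : Module.End ℝ V} (h : X * Y - Y * X = μ • Z) :
      φ (μ⁻¹ • X) * φ (μ⁻¹ • Y) = φ (μ⁻¹ • Y) * φ (μ⁻¹ • X) + φ (μ⁻¹ • Z) := by
    rw [← map_mul, ← map_mul, ← map_add]
    congr 1
    have h' : X * Y = Y * X + μ • Z := by rw [← h]; abel
    simp only [smul_mul_smul_comm, h', smul_add, smul_smul]
    congr 2
    field_simp
  have hxy : x * y = y * x + z := hrel hXY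
  have hyz : y * z = z * y + x := hrel hYZ
  have hzx : z * x = x * z + y := hrel hZX
  have hcas : x * x + y * y + z * z = -((c / μ ^ 2 : ℝ) : ℂ) • 1 := by
    have h : φ (μ⁻¹ ^ 2 • (X * X + Y * Y + Z * Z)) = -((c / μ ^ 2 : ℝ) : ℂ) • 1 := by
      rw [hc, smul_smul, hφs, map_one]
      congr 1
      push_cast
      field_simp
    rw [← h, hx, hy, hz, ← map_mul, ← map_mul, ← map_mul, ← map_add, ← map_add]
    congr 1
    simp only [smul_mul_smul_comm, smul_add, sq]
  have t : IsSl2Triple ((2 * Complex.I) • x) (y + Complex.I • z) (Complex.I • z - y) := by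
    refine ⟨?_, ?_, ?_, ?_⟩
    · refine smul_ne_zero (by simp) fun h => hX ?_
      have := hφ (h.trans (map_zero φ).symm)
      simpa [hμ] using this
    all_goals
      simp only [Ring.lie_def, mul_add, add_mul, mul_sub, sub_mul, smul_mul_assoc, mul_smul_comm,
        hxy, hyz, hzx, smul_add, smul_sub, smul_smul]
      match_scalars <;> ring_nf <;> simp
  obtain ⟨m, ν, hm⟩ := exists_hasPrimitiveVectorWith t
  obtain ⟨n, rfl⟩ := hm.exists_nat
  refine ⟨n, ?_⟩
  have hxm : x m = (-(Complex.I * n / 2)) • m := by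
    have h : (2 * Complex.I) • x m = (n : ℂ) • m := hm.lie_h
    have := congrArg (fun w => (-(Complex.I / 2)) • w) h
    simp only [smul_smul] at this
    rw [show -(Complex.I / 2) * (2 * Complex.I) = 1 by ring_nf; simp, one_smul] at this
    rw [this]
    congr 1
    ring
  have hym : y m = -(Complex.I • z m) := by
    have h : y m + Complex.I • z m = 0 := hm.lie_e
    exact eq_neg_of_add_eq_zero_left h
  have h₁ : x (x m) = (-(n ^ 2 / 4 : ℂ)) • m := by
    rw [hxm, map_smul, hxm, smul_smul]
    congr 1
    ring_nf
    simp
    ring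
  have h₂ : y (y m) + z (z m) = (-(n / 2 : ℂ)) • m := by
    have h : y (z m) = z (y m) + x m := LinearMap.congr_fun hyz m
    rw [hym, map_neg, map_smul, h, hym, hxm, map_neg, map_smul]
    match_scalars <;> ring_nf <;> simp [div_eq_mul_inv]
  have h₃ : x (x m) + y (y m) + z (z m) = (-((c / μ ^ 2 : ℝ) : ℂ)) • m :=
    LinearMap.congr_fun hcas m
  rw [add_assoc, h₁, h₂, ← add_smul] at h₃
  have h₄ := smul_left_injective ℂ hm.ne_zero h₃
  have h₅ : c / μ ^ 2 = n * (n + 2) / 4 := by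
    have : ((c / μ ^ 2 : ℝ) : ℂ) = ((n * (n + 2) / 4 : ℝ) : ℂ) := by
      push_cast at h₄ ⊢
      linear_combination h₄
    exact_mod_cast this
  rw [← h₅]
  field_simp

end Module.End

/-! ### Sums of structure constants over a subalgebra -/

namespace WallachData

open Module LieModule

set_option linter.unusedSectionVars false

variable {g : Type*} [LieRing g] [LieAlgebra ℝ g] [FiniteDimensional ℝ g] {D : WallachData g}

/-- The negative of the Killing form of `g`, restricted to a subspace. -/
noncomputable abbrev negKilling (W : Submodule ℝ g) : LinearMap.BilinForm ℝ W :=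
  (-killingForm ℝ g : LinearMap.BilinForm ℝ g).restrict W

lemma killingForm_lie_left (x y z : g) :
    killingForm ℝ g ⁅x, y⁆ z = -killingForm ℝ g y ⁅x, z⁆ := by
  rw [← lie_skew, map_neg, LinearMap.neg_apply, LieModule.traceForm_apply_lie_apply]

lemma killingForm_comm (x y : g) : killingForm ℝ g x y = killingForm ℝ g y x :=
  LieModule.traceForm_comm ℝ g g x y

/-- The sum of the squares of the structure constants `B([x, e_β], e_γ)` with `e_β` and `e_γ` in the
bases of two summands. -/
noncomputable def AdaptedBasis.adCoeff (E : D.AdaptedBasis) (j k : Summand) (x : g) : ℝ :=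
  ∑ β, ∑ γ, (-killingForm ℝ g ⁅x, (E.e j β : g)⁆ (E.e k γ : g)) ^ 2

lemma AdaptedBasis.coeff_eq_sum_adCoeff (E : D.AdaptedBasis) (i j k : Summand) :
    E.coeff i j k = ∑ α, E.adCoeff j k (E.e i α : g) := rfl

variable (hD : D.IsWallachTriple) (E : D.AdaptedBasis)

include hD in
/-- The bases of some of the summands together are a basis of the sum of these summands, which is
orthonormal. -/
lemma exists_basis_of_eq_iSup {m : ℕ} {s : Fin m → Summand} (hs : Function.Injective s)
    {W : Submodule ℝ g} (hW : W = ⨆ a, D.summand (s a)) :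
    ∃ b : Basis (Σ a, Fin (finrank ℝ (D.summand (s a)))) ℝ W,
      (∀ p, (b p : g) = E.e (s p.1) p.2) ∧
      ∀ p q, negKilling W (b p) (b q) = if p = q then 1 else 0 := by
  have hle (a : Fin m) : D.summand (s a) ≤ W := hW ▸ le_iSup (fun a => D.summand (s a)) a
  let v : (Σ a, Fin (finrank ℝ (D.summand (s a)))) → W :=
    fun p => ⟨E.e (s p.1) p.2, hle p.1 (E.e (s p.1) p.2).2⟩
  have hv (p q) : negKilling W (v p) (v q) = if p = q then 1 else 0 := by
    change -killingForm ℝ g (E.e (s p.1) p.2 : g) (E.e (s q.1) q.2 : g) = _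
    obtain ⟨a, α⟩ := p
    obtain ⟨c, γ⟩ := q
    by_cases hac : a = c
    · subst hac
      rw [E.orthonormal]
      simp
    · rw [hD.orthogonal _ _ (hs.ne hac) _ (E.e (s a) α).2 _ (E.e (s c) γ).2]
      simp [hac]
  have hli : LinearIndependent ℝ v := by
    refine Fintype.linearIndependent_iff.2 fun f hf p => ?_
    have := congrArg (negKilling W (v p)) hf
    simpa only [map_sum, map_smul, hv, smul_eq_mul, mul_ite, mul_one, mul_zero, map_zero,
      Finset.sum_ite_eq, Finset.mem_univ, if_true] using this
  have hspan : ⊤ ≤ Submodule.span ℝ (Set.range v) := by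
    have h₁ : W ≤ (Submodule.span ℝ (Set.range v)).map W.subtype := by
      conv_lhs => rw [hW]
      refine iSup_le fun a => ?_
      intro x hx
      have hx' := (E.e (s a)).mem_span ⟨x, hx⟩
      have h₂ := Submodule.mem_map_of_mem (f := (D.summand (s a)).subtype) hx'
      rw [Submodule.map_span, ← Set.range_comp] at h₂ ⊢
      refine Submodule.span_mono ?_ h₂
      rintro _ ⟨α, rfl⟩
      exact ⟨⟨a, α⟩, rfl⟩
    intro x _
    obtain ⟨y, hy, hyx⟩ := h₁ x.2
    rwa [← Subtype.ext (show (y : g) = x from hyx)]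
  refine ⟨Basis.mk hli hspan, fun p => by rw [Basis.mk_apply], fun p q => ?_⟩
  rw [Basis.mk_apply, Basis.mk_apply, hv]

include hD E in
lemma finrank_eq_sum_of_eq_iSup {m : ℕ} {s : Fin m → Summand} (hs : Function.Injective s)
    {W : Submodule ℝ g} (hW : W = ⨆ a, D.summand (s a)) :
    finrank ℝ W = ∑ a, finrank ℝ (D.summand (s a)) := by
  obtain ⟨b, -⟩ := exists_basis_of_eq_iSup hD E hs hW
  simp [finrank_eq_card_basis b]

include hD in
/-- The sum of all `B([x, e_β], e_γ)²`, with `e_β` and `e_γ` in a basis of a subalgebra, is minus the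
value at `x` of the Killing form of this subalgebra. -/
lemma sum_adCoeff_eq_neg_killingForm {m : ℕ} {s : Fin m → Summand} (hs : Function.Injective s)
    {h : LieSubalgebra ℝ g} (hh : h.toSubmodule = ⨆ a, D.summand (s a)) (x : h) :
    ∑ a, ∑ c, E.adCoeff (s a) (s c) x = -killingForm ℝ h x x := by
  obtain ⟨b, hbe, hb⟩ := exists_basis_of_eq_iSup hD E hs hh
  have h₁ : killingForm ℝ h x x = ∑ p, negKilling h.toSubmodule (b p) ⁅x, ⁅x, (b p : h)⁆⁆ := by
    rw [killingForm_apply_apply]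
    exact LinearMap.BilinForm.trace_eq_of_orthonormal hb (V := h) _
  have h₂ (p) : -negKilling h.toSubmodule (b p) ⁅x, ⁅x, (b p : h)⁆⁆ =
      ∑ q, (-killingForm ℝ g ⁅(x : g), (b p : g)⁆ (b q : g)) ^ 2 := by
    have := LinearMap.BilinForm.sum_sq_of_orthonormal hb (⁅x, (b p : h)⁆ : h)
    refine Eq.trans ?_ this
    change - -killingForm ℝ g (b p : g) ⁅(x : g), ⁅(x : g), (b p : g)⁆⁆ =
      -killingForm ℝ g ⁅(x : g), (b p : g)⁆ ⁅(x : g), (b p : g)⁆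
    rw [killingForm_lie_left (x : g)]
  rw [h₁, ← Finset.sum_neg_distrib, Finset.sum_congr rfl fun p _ => h₂ p]
  simp only [hbe, Fintype.sum_sigma, AdaptedBasis.adCoeff]
  refine Finset.sum_congr rfl fun a _ => ?_
  rw [Finset.sum_comm]

include hD in
/-- If the Killing form of a subalgebra is `c` times the restriction of the Killing form of `g`, then
the numbers `(ijk)` with `j` and `k` in the subalgebra add up to `c` times the dimension of the
`i`-th summand. -/
lemma sum_coeff_eq_mul_finrank {m : ℕ} {s : Fin m → Summand} (hs : Function.Injective s)
    {h : LieSubalgebra ℝ g} (hh : h.toSubmodule = ⨆ a, D.summand (s a)) {c : ℝ}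
    (hc : ∀ x y : h, killingForm ℝ h x y = c * killingForm ℝ g x y) (i : Summand)
    (hi : ∃ a, s a = i) :
    ∑ a, ∑ b, E.coeff i (s a) (s b) = c * finrank ℝ (D.summand i) := by
  have hle : D.summand i ≤ h.toSubmodule := by
    obtain ⟨a, rfl⟩ := hi
    exact hh ▸ le_iSup (fun a => D.summand (s a)) a
  have h₁ (α) : ∑ a, ∑ b, E.adCoeff (s a) (s b) (E.e i α : g) = c := by
    have := sum_adCoeff_eq_neg_killingForm hD E hs hh ⟨_, hle (E.e i α).2⟩
    rw [hc] at this
    rw [this, ← mul_neg, E.orthonormal, if_pos rfl, mul_one]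
  calc ∑ a, ∑ b, E.coeff i (s a) (s b)
      = ∑ α, ∑ a, ∑ b, E.adCoeff (s a) (s b) (E.e i α : g) := by
        simp only [AdaptedBasis.coeff_eq_sum_adCoeff]
        exact (Finset.sum_congr rfl fun _ _ => Finset.sum_comm).trans Finset.sum_comm
    _ = c * finrank ℝ (D.summand i) := by simp [h₁, mul_comm]

/-- The Killing form of a subalgebra without proper ideals is proportional to the restriction of the
Killing form of `g`, if the latter is negative definite. -/
lemma exists_killingForm_eq_mul {h : LieSubalgebra ℝ g} [Nontrivial h]
    {ι : Type*} [Fintype ι] [DecidableEq ι]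
    {b : Basis ι ℝ h.toSubmodule}
    (hb : ∀ i j, negKilling h.toSubmodule (b i) (b j) = if i = j then 1 else 0)
    (hsimple : ∀ I : LieIdeal ℝ h, I = ⊥ ∨ I = ⊤) :
    ∃ c : ℝ, ∀ x y : h, killingForm ℝ h x y = c * killingForm ℝ g x y := by
  have key : ∃ c : ℝ, ∀ x y : h, killingForm ℝ h x y = c * negKilling h.toSubmodule x y := by
    refine LinearMap.BilinForm.exists_eq_smul_of_irreducible (V := h) hb
      (fun v w => LieModule.traceForm_comm ℝ h h v w)
      (Set.range fun x : h => (LieAlgebra.ad ℝ h x : h →ₗ[ℝ] h)) ?_ ?_ ?_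
    · rintro _ ⟨x, rfl⟩ v w
      exact congrArg Neg.neg (killingForm_lie_left (x : g) v w)
    · rintro _ ⟨x, rfl⟩ v w
      exact killingForm_lie_left x v w
    · intro W hW
      let I : LieIdeal ℝ h := { W with lie_mem := fun {x m} hm => hW _ ⟨x, rfl⟩ m hm }
      exact (hsimple I).imp (fun h => congrArg LieSubmodule.toSubmodule h)
        (fun h => congrArg LieSubmodule.toSubmodule h)
  obtain ⟨c, hc⟩ := key
  refine ⟨-c, fun x y => (hc x y).trans ?_⟩
  change c * -killingForm ℝ g x y = -c * killingForm ℝ g x y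
  ring

end WallachData

/-! ### The vanishing structure constants -/

instance : DecidableEq Summand := fun a b => by
  cases a <;> cases b <;> first | exact isTrue rfl | exact isFalse nofun

instance : Fintype Summand :=
  ⟨{.k₁, .k₂, .k₃, .m₁, .m₂, .m₃}, by rintro ⟨⟩ <;> decide⟩

namespace Summand

/-- The eigenvalue of `θ` on a summand. -/
def signθ : Summand → ℤ
  | .m₂ | .m₃ => -1
  | _ => 1

/-- The eigenvalue of `τ` on a summand. -/
def signτ : Summand → ℤ
  | .m₁ | .m₃ => -1
  | _ => 1

end Summand

namespace WallachData

open Module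

set_option linter.unusedSectionVars false

variable {g : Type*} [LieRing g] [LieAlgebra ℝ g] [FiniteDimensional ℝ g] {D : WallachData g}

namespace IsWallachTriple

variable (hD : D.IsWallachTriple)

include hD

lemma summand_le_k {i : Summand} (hθ : i.signθ = 1) (hτ : i.signτ = 1) :
    D.summand i ≤ D.k.toSubmodule := by
  cases i
  · exact hD.ideal_k₁.1
  · exact hD.ideal_k₂.1
  · exact hD.ideal_k₃.1
  · exact absurd hτ (by decide)
  · exact absurd hθ (by decide)
  · exact absurd hθ (by decide)

lemma θ_apply {i : Summand} {x : g} (hx : x ∈ D.summand i) : D.θ x = (i.signθ : ℝ) • x := by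
  have hk (h : x ∈ D.k) : D.θ x = x := h.1
  cases i <;> simp only [Summand.signθ, Int.cast_one, one_smul, Int.cast_neg, neg_smul]
  · exact hk (hD.ideal_k₁.1 hx)
  · exact hk (hD.ideal_k₂.1 hx)
  · exact hk (hD.ideal_k₃.1 hx)
  · exact hx.1
  · exact hx.1
  · exact hx.1

lemma τ_apply {i : Summand} {x : g} (hx : x ∈ D.summand i) : D.τ x = (i.signτ : ℝ) • x := by
  have hk (h : x ∈ D.k) : D.τ x = x := h.2
  cases i <;> simp only [Summand.signτ, Int.cast_one, one_smul, Int.cast_neg, neg_smul]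
  · exact hk (hD.ideal_k₁.1 hx)
  · exact hk (hD.ideal_k₂.1 hx)
  · exact hk (hD.ideal_k₃.1 hx)
  · exact hx.2
  · exact hx.2
  · exact hx.2

lemma lie_mem_of_signs_eq_one {i j : Summand} (hθi : i.signθ = 1) (hτi : i.signτ = 1)
    (hθj : j.signθ = 1) (hτj : j.signτ = 1) {x y : g} (hx : x ∈ D.summand i)
    (hy : y ∈ D.summand j) : ⁅x, y⁆ ∈ D.summand j := by
  have hx' := hD.summand_le_k hθi hτi hx
  cases j
  · exact hD.ideal_k₁.2 x hx' y hy
  · exact hD.ideal_k₂.2 x hx' y hy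
  · exact hD.ideal_k₃.2 x hx' y hy
  · exact absurd hτj (by decide)
  · exact absurd hθj (by decide)
  · exact absurd hθj (by decide)

end IsWallachTriple

lemma killingForm_map (φ : g ≃ₗ⁅ℝ⁆ g) (x y : g) :
    killingForm ℝ g (φ x) (φ y) = killingForm ℝ g x y :=
  LieAlgebra.killingForm_of_equiv_apply φ x y

namespace AdaptedBasis

variable (E : D.AdaptedBasis)

lemma coeff_swap (i j k : Summand) : E.coeff i j k = E.coeff j i k := by
  rw [coeff, coeff, Finset.sum_comm]
  refine Finset.sum_congr rfl fun β _ => Finset.sum_congr rfl fun α _ =>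
    Finset.sum_congr rfl fun γ _ => ?_
  rw [← lie_skew, map_neg, LinearMap.neg_apply, neg_neg, neg_sq]

lemma coeff_rotate (i j k : Summand) : E.coeff i j k = E.coeff j k i := by
  rw [coeff, coeff, Finset.sum_comm]
  refine Finset.sum_congr rfl fun β _ => ?_
  rw [Finset.sum_comm]
  refine Finset.sum_congr rfl fun γ _ => Finset.sum_congr rfl fun α _ => ?_
  rw [LieModule.traceForm_apply_lie_apply, ← killingForm_comm]

lemma coeff_eq_zero {i j k : Summand}
    (h : ∀ x ∈ D.summand i, ∀ y ∈ D.summand j, ∀ z ∈ D.summand k,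
      killingForm ℝ g ⁅x, y⁆ z = 0) : E.coeff i j k = 0 := by
  refine Finset.sum_eq_zero fun α _ => Finset.sum_eq_zero fun β _ =>
    Finset.sum_eq_zero fun γ _ => ?_
  rw [h _ (E.e i α).2 _ (E.e j β).2 _ (E.e k γ).2]
  simp

variable (hD : D.IsWallachTriple)

include hD

lemma coeff_eq_zero_of_sign {i j k : Summand}
    (h : i.signθ * j.signθ * k.signθ = -1 ∨ i.signτ * j.signτ * k.signτ = -1) :
    E.coeff i j k = 0 := by
  refine E.coeff_eq_zero fun x hx y hy z hz => ?_
  have aux {φ : g ≃ₗ⁅ℝ⁆ g} {a b c : ℤ} (hx : φ x = (a : ℝ) • x) (hy : φ y = (b : ℝ) • y)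
      (hz : φ z = (c : ℝ) • z) (h : a * b * c = -1) : killingForm ℝ g ⁅x, y⁆ z = 0 := by
    have h₁ := killingForm_map φ ⁅x, y⁆ z
    rw [LieEquiv.map_lie, hx, hy, hz, smul_lie, lie_smul, map_smul, map_smul, map_smul,
      LinearMap.smul_apply, LinearMap.smul_apply, smul_smul, smul_smul, smul_eq_mul] at h₁
    have h₂ : (c * a * b : ℝ) = -1 := by
      rw [mul_assoc, mul_comm]
      exact_mod_cast h
    rw [h₂] at h₁
    linarith
  exact h.elim (aux (hD.θ_apply hx) (hD.θ_apply hy) (hD.θ_apply hz))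
    (aux (hD.τ_apply hx) (hD.τ_apply hy) (hD.τ_apply hz))

lemma coeff_eq_zero_of_ne {i j k : Summand} (hθi : i.signθ = 1) (hτi : i.signτ = 1)
    (hθj : j.signθ = 1) (hτj : j.signτ = 1) (h : i ≠ k ∨ j ≠ k) : E.coeff i j k = 0 := by
  refine E.coeff_eq_zero fun x hx y hy z hz => ?_
  rcases h with h | h
  · refine hD.orthogonal i k h _ ?_ z hz
    rw [← lie_skew]
    exact (D.summand i).neg_mem (hD.lie_mem_of_signs_eq_one hθj hτj hθi hτi hy hx)
  · exact hD.orthogonal j k h _ (hD.lie_mem_of_signs_eq_one hθi hτi hθj hτj hx hy) z hz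

/-- A structure constant vanishes for one of two reasons: `(θ, τ)` gives a grading of `g`, and the
`𝔨ᵢ` are ideals of `𝔨`. -/
theorem coeff_eq_zero_of_notMem (i j k : Summand)
    (h : ({i, j, k} : Multiset Summand) ∉ listedTriples) : E.coeff i j k = 0 := by
  have key : ∀ i j k : Summand,
      (i.signθ * j.signθ * k.signθ = -1 ∨ i.signτ * j.signτ * k.signτ = -1) ∨
      ((i.signθ = 1 ∧ i.signτ = 1 ∧ j.signθ = 1 ∧ j.signτ = 1) ∧ (i ≠ k ∨ j ≠ k)) ∨
      ({i, j, k} : Multiset Summand) ∈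
        ([{.k₁, .k₁, .k₁}, {.k₂, .k₂, .k₂}, {.k₃, .k₃, .k₃},
          {.k₁, .m₁, .m₁}, {.k₁, .m₂, .m₂}, {.k₁, .m₃, .m₃},
          {.k₂, .m₁, .m₁}, {.k₂, .m₂, .m₂}, {.k₂, .m₃, .m₃},
          {.k₃, .m₁, .m₁}, {.k₃, .m₂, .m₂}, {.k₃, .m₃, .m₃},
          {.m₁, .m₂, .m₃}] : List (Multiset Summand)) := by
    decide +kernel
  rcases key i j k with h' | ⟨⟨h₁, h₂, h₃, h₄⟩, h'⟩ | h'
  · exact E.coeff_eq_zero_of_sign hD h'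
  · exact E.coeff_eq_zero_of_ne hD h₁ h₂ h₃ h₄ h'
  · refine absurd ?_ h
    simpa only [listedTriples, List.mem_cons, List.not_mem_nil, or_false, Set.mem_insert_iff,
      Set.mem_singleton_iff] using h'

end AdaptedBasis

end WallachData

/-! ### The Casimir operator of a three-dimensional ideal on an irreducible summand -/

namespace WallachData

open Module

set_option linter.unusedSectionVars false

variable {g : Type*} [LieRing g] [LieAlgebra ℝ g] [FiniteDimensional ℝ g] {D : WallachData g}

namespace AdaptedBasis

variable (E : D.AdaptedBasis)

lemma negKilling_basis (i : Summand) (α β : Fin (finrank ℝ (D.summand i))) :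
    negKilling (D.summand i) (E.e i α) (E.e i β) = if α = β then 1 else 0 :=
  E.orthonormal i α β

lemma eq_sum_smul {i : Summand} {x : g} (hx : x ∈ D.summand i) :
    x = ∑ α, (-killingForm ℝ g (E.e i α : g) x) • (E.e i α : g) := by
  have h := congrArg (D.summand i).subtype ((E.e i).sum_repr ⟨x, hx⟩)
  simp only [LinearMap.BilinForm.repr_eq_of_orthonormal (E.negKilling_basis i), map_sum,
    map_smul] at h
  exact h.symm

/-- The Casimir form of the `i`-th summand on `g`. -/
noncomputable def casimirForm (i : Summand) : LinearMap.BilinForm ℝ g :=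
  ∑ α, (-killingForm ℝ g).compl₁₂ (LieAlgebra.ad ℝ g (E.e i α : g)) (LieAlgebra.ad ℝ g (E.e i α : g))

lemma casimirForm_apply (i : Summand) (v w : g) : E.casimirForm i v w =
    ∑ α, -killingForm ℝ g ⁅(E.e i α : g), v⁆ ⁅(E.e i α : g), w⁆ := by
  simp [casimirForm]

lemma casimirForm_comm (i : Summand) (v w : g) : E.casimirForm i v w = E.casimirForm i w v := by
  simp only [casimirForm_apply]
  exact Finset.sum_congr rfl fun α _ => by rw [killingForm_comm]

/-- The Casimir form of a summand is invariant under every element whose adjoint action preserves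
this summand. -/
lemma casimirForm_lie {i : Summand} {x : g} (hx : ∀ y ∈ D.summand i, ⁅x, y⁆ ∈ D.summand i)
    (v w : g) : E.casimirForm i ⁅x, v⁆ w = -E.casimirForm i v ⁅x, w⁆ := by
  rw [eq_neg_iff_add_eq_zero, casimirForm_apply, casimirForm_apply, ← Finset.sum_add_distrib]
  set e := fun α => (E.e i α : g)
  let a := fun α β => -killingForm ℝ g (e β) ⁅x, e α⁆
  have ha (α β) : a α β = -a β α := by
    simp only [a]
    rw [killingForm_comm, killingForm_lie_left]
  have hxe (α) : ⁅x, e α⁆ = ∑ β, a α β • e β := E.eq_sum_smul (hx _ (E.e i α).2)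
  let T := fun α β => killingForm ℝ g ⁅e α, v⁆ ⁅e β, w⁆
  have h₁ (α) : -killingForm ℝ g ⁅e α, ⁅x, v⁆⁆ ⁅e α, w⁆ + -killingForm ℝ g ⁅e α, v⁆ ⁅e α, ⁅x, w⁆⁆ =
      ∑ β, a α β * (T β α + T α β) := by
    have hl (y : g) : ⁅e α, ⁅x, y⁆⁆ = ⁅x, ⁅e α, y⁆⁆ - ∑ β, a α β • ⁅e β, y⁆ := by
      have : ⁅⁅x, e α⁆, y⁆ = ∑ β, a α β • ⁅e β, y⁆ := by
        rw [hxe, LieModule.toEnd_apply_apply ℝ g g _ y |>.symm]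
        simp
      rw [← this, leibniz_lie x, add_sub_cancel_left]
    rw [hl, hl, map_sub, map_sub, LinearMap.sub_apply, killingForm_lie_left]
    simp only [map_sum, map_smul, LinearMap.sum_apply, LinearMap.smul_apply, smul_eq_mul, mul_add,
      Finset.sum_add_distrib]
    simp only [T]
    ring
  have h₂ : ∑ α, ∑ β, a α β * (T β α + T α β) = -∑ α, ∑ β, a α β * (T β α + T α β) := by
    conv_lhs => rw [Finset.sum_comm]
    simp only [← Finset.sum_neg_distrib]
    refine Finset.sum_congr rfl fun α _ => Finset.sum_congr rfl fun β _ => ?_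
    rw [ha β α]
    ring
  rw [Finset.sum_congr rfl fun α _ => h₁ α]
  linarith

lemma coeff_eq_sum_casimirForm {i j : Summand}
    (h : ∀ x ∈ D.summand i, ∀ y ∈ D.summand j, ⁅x, y⁆ ∈ D.summand j) :
    E.coeff i j j = ∑ β, E.casimirForm i (E.e j β : g) (E.e j β : g) := by
  simp only [casimirForm_apply]
  rw [coeff, Finset.sum_comm, Finset.sum_comm]
  refine Finset.sum_comm.trans (Finset.sum_congr rfl fun β _ => Finset.sum_congr rfl fun α _ => ?_)
  exact (LinearMap.BilinForm.sum_sq_of_orthonormal (E.negKilling_basis j)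
    ⟨_, h _ (E.e i α).2 _ (E.e j β).2⟩).symm

/-- An irreducible summand on which a three-dimensional ideal of `𝔨` acts nontrivially makes a large
structure constant: the Casimir operator acts on it as a scalar, which is the value on an irreducible
representation of `𝔰𝔲(2)` of highest weight at least one. -/
theorem coeff_eq_zero_or_le {i j : Summand} (hi : finrank ℝ (D.summand i) = 3)
    (hki : ∀ x ∈ D.k, ∀ y ∈ D.summand i, ⁅x, y⁆ ∈ D.summand i) (hik : D.summand i ≤ D.k.toSubmodule)
    (hj : IsIrreducibleUnder D.k (D.summand j)) :
    E.coeff i j j = 0 ∨ finrank ℝ (D.summand j) / 8 * E.coeff i i i ≤ E.coeff i j j := by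
  set V := D.summand j
  have : Nontrivial V := Submodule.nontrivial_iff_ne_bot.2 hj.1
  have hb := E.negKilling_basis j
  -- the restriction to `V` of the adjoint action of an element of `𝔨`
  let A : D.k → V →ₗ[ℝ] V := fun x => (LieAlgebra.ad ℝ g (x : g)).restrict (hj.2.1 x x.2)
  obtain ⟨c, hc⟩ := LinearMap.BilinForm.exists_eq_smul_of_irreducible hb
    (C := (E.casimirForm i).restrict V) (fun v w => E.casimirForm_comm i v w) (Set.range A)
    (by rintro _ ⟨x, rfl⟩ v w; exact congrArg Neg.neg (killingForm_lie_left (x : g) v w))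
    (by rintro _ ⟨x, rfl⟩ v w; exact E.casimirForm_lie (hki x x.2) v w)
    (by
      intro W hW
      have h := hj.2.2 (W.map V.subtype) (Submodule.map_subtype_le V W) (by
        rintro x hx _ ⟨w, hw, rfl⟩
        exact ⟨_, hW _ ⟨⟨x, hx⟩, rfl⟩ w hw, rfl⟩)
      refine h.imp (fun h => ?_) (fun h => ?_)
      · refine Submodule.map_injective_of_injective V.injective_subtype ?_
        rw [h, Submodule.map_bot]
      · refine Submodule.map_injective_of_injective V.injective_subtype ?_
        rw [h, Submodule.map_top, Submodule.range_subtype])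
  have hcoeff : E.coeff i j j = finrank ℝ V * c := by
    rw [E.coeff_eq_sum_casimirForm fun x hx => hj.2.1 x (hik hx)]
    have hβ (β : Fin (finrank ℝ (D.summand j))) :
        E.casimirForm i (E.e j β : g) (E.e j β : g) = c :=
      (hc (E.e j β) (E.e j β)).trans (by rw [hb, if_pos rfl, mul_one])
    simp [hβ, V]
  -- an orthonormal basis of the ideal, indexed by `Fin 3`
  let e : Fin 3 → g := fun a => E.e i (Fin.cast hi.symm a)
  have hsum (f : g → ℝ) : ∑ α, f (E.e i α) = ∑ a, f (e a) :=
    ((finCongr hi.symm).sum_comp fun α => f (E.e i α)).symm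
  have he (a) : e a ∈ D.summand i := (E.e i _).2
  let T : Fin 3 → Fin 3 → Fin 3 → ℝ := fun a b c => -killingForm ℝ g ⁅e a, e b⁆ (e c)
  have hT₁ (a b c) : T a b c = T b c a := by
    simp only [T]
    rw [LieModule.traceForm_apply_lie_apply, ← killingForm_comm]
  have hT₂ (a b c) : T b a c = -T a b c := by
    simp only [T]
    rw [← lie_skew, map_neg, LinearMap.neg_apply]
  have hT₃ (a c) : T a a c = 0 := by simp [T]
  have hT₄ (a c) : T a c c = 0 := by rw [hT₁, hT₁, hT₁, hT₁, hT₃]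
  set μ := T 0 1 2 with hμ
  have hiii : E.coeff i i i = 6 * μ ^ 2 := by
    have h : E.coeff i i i = ∑ a, ∑ b, ∑ c, T a b c ^ 2 :=
      (hsum fun x => ∑ β, ∑ γ, (-killingForm ℝ g ⁅x, (E.e i β : g)⁆ (E.e i γ : g)) ^ 2).trans <|
        Finset.sum_congr rfl fun a _ =>
          (hsum fun y => ∑ γ, (-killingForm ℝ g ⁅e a, y⁆ (E.e i γ : g)) ^ 2).trans <|
            Finset.sum_congr rfl fun b _ => hsum fun z => (-killingForm ℝ g ⁅e a, e b⁆ z) ^ 2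
    have h₁ : T 1 2 0 = μ := (hT₁ 0 1 2).symm
    have h₂ : T 2 0 1 = μ := (hT₁ 1 2 0).symm.trans h₁
    have h₃ : T 1 0 2 = -μ := hT₂ 0 1 2
    have h₄ : T 2 1 0 = -μ := (hT₂ 1 2 0).trans (congrArg Neg.neg h₁)
    have h₅ : T 0 2 1 = -μ := (hT₂ 2 0 1).trans (congrArg Neg.neg h₂)
    have hT₅ (a b) : T a b a = 0 := by rw [hT₁, hT₄]
    rw [h]
    simp only [Fin.sum_univ_three, hT₃, hT₄, hT₅, h₁, h₂, h₃, h₄, h₅, ← hμ]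
    ring
  -- the cyclic products are those of an orthogonal basis of `𝔰𝔲(2)`
  have hlie (a b : Fin 3) (x : g) : ⁅⁅e a, e b⁆, x⁆ = ∑ c, T a b c • ⁅e c, x⁆ := by
    have h := E.eq_sum_smul (hki _ (hik (he a)) _ (he b))
    have h' : ⁅e a, e b⁆ = ∑ c, T a b c • e c := by
      refine h.trans (((finCongr hi.symm).sum_comp _).symm.trans ?_)
      refine Finset.sum_congr rfl fun c _ => ?_
      rw [killingForm_comm]
      rfl
    conv_lhs => rw [h', ← LieModule.toEnd_apply_apply ℝ g g]
    simp
  let X : Fin 3 → Module.End ℝ V := fun a => A ⟨e a, hik (he a)⟩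
  have hX (a : Fin 3) (v : V) : ((X a v : V) : g) = ⁅e a, (v : g)⁆ := rfl
  have hbr (a b c : Fin 3) (h : ∀ x : g, ∑ d, T a b d • ⁅e d, x⁆ = μ • ⁅e c, x⁆) :
      X a * X b - X b * X a = μ • X c := by
    ext v
    change ⁅e a, ⁅e b, (v : g)⁆⁆ - ⁅e b, ⁅e a, (v : g)⁆⁆ = μ • ⁅e c, (v : g)⁆
    rw [← lie_lie, hlie, h]
  have hcas : X 0 * X 0 + X 1 * X 1 + X 2 * X 2 = -c • 1 := by
    refine LinearMap.ext fun v => (E.e j).ext_elem fun β => ?_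
    rw [LinearMap.BilinForm.repr_eq_of_orthonormal hb, LinearMap.BilinForm.repr_eq_of_orthonormal hb]
    have h := hc (E.e j β) v
    have h' : E.casimirForm i (E.e j β : g) (v : g) =
        ∑ a, -killingForm ℝ g ⁅e a, (E.e j β : g)⁆ ⁅e a, (v : g)⁆ :=
      (E.casimirForm_apply _ _ _).trans
        (hsum fun x => -killingForm ℝ g ⁅x, (E.e j β : g)⁆ ⁅x, (v : g)⁆)
    change E.casimirForm i (E.e j β : g) (v : g) = c * -killingForm ℝ g (E.e j β : g) (v : g) at h
    rw [h', Fin.sum_univ_three] at h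
    simp only [killingForm_lie_left (e _)] at h
    change -killingForm ℝ g (E.e j β : g) (⁅e 0, ⁅e 0, (v : g)⁆⁆ + ⁅e 1, ⁅e 1, (v : g)⁆⁆ +
      ⁅e 2, ⁅e 2, (v : g)⁆⁆) = -killingForm ℝ g (E.e j β : g) (-c • (v : g))
    rw [map_add, map_add, map_smul, smul_eq_mul]
    linarith
  by_cases hμ₀ : μ = 0
  · right
    rw [hiii, hμ₀]
    simp only [ne_eq, OfNat.ofNat_ne_zero, not_false_eq_true, zero_pow, mul_zero]
    exact Finset.sum_nonneg fun _ _ => Finset.sum_nonneg fun _ _ =>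
      Finset.sum_nonneg fun _ _ => sq_nonneg _
  obtain ⟨n, hn⟩ := Module.End.exists_casimir_eq hμ₀
    (hbr 0 1 2 fun x => by simp [Fin.sum_univ_three, hT₄, hT₁ 0 1 0, ← hμ])
    (hbr 1 2 0 fun x => by simp [Fin.sum_univ_three, hT₄, hT₁ 1 2 1, ← hT₁ 0 1 2, ← hμ])
    (hbr 2 0 1 fun x => by
      simp [Fin.sum_univ_three, hT₄, hT₁ 2 0 2, ← hT₁ 1 2 0, ← hT₁ 0 1 2, ← hμ]) hcas
  rcases Nat.eq_zero_or_pos n with rfl | hn₀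
  · left
    rw [hcoeff, hn]
    simp
  · right
    rw [hcoeff, hiii, hn]
    have h₁ : (1 : ℝ) ≤ n := by exact_mod_cast hn₀
    have h₂ : (3 : ℝ) / 4 ≤ n * (n + 2) / 4 := by nlinarith
    have h₃ := mul_le_mul_of_nonneg_left h₂
      (mul_nonneg (Nat.cast_nonneg (finrank ℝ V)) (sq_nonneg μ) : (0 : ℝ) ≤ finrank ℝ V * μ ^ 2)
    calc (finrank ℝ V : ℝ) / 8 * (6 * μ ^ 2) = finrank ℝ V * μ ^ 2 * (3 / 4) := by ring
      _ ≤ finrank ℝ V * μ ^ 2 * (n * (n + 2) / 4) := h₃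
      _ = finrank ℝ V * (μ ^ 2 * (n * (n + 2) / 4)) := by ring

end AdaptedBasis

end WallachData

/-! ### The linear equations between the structure constants -/

namespace WallachData

open Module

set_option linter.unusedSectionVars false

variable {g : Type*} [LieRing g] [LieAlgebra ℝ g] [FiniteDimensional ℝ g] {D : WallachData g}

namespace IsWallachTriple

variable (hD : D.IsWallachTriple)

include hD

lemma b₂_eq_iSup : D.b₂.toSubmodule =
    ⨆ a, D.summand ((![.k₂, .k₃, .m₂] : Fin 3 → Summand) a) := by
  rw [hD.b₂_eq, iSup_fin_three]
  rfl

lemma fixedSubalgebra_θ_eq_iSup : (fixedSubalgebra D.θ).toSubmodule =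
    ⨆ a, D.summand ((![.k₁, .k₂, .k₃, .m₁] : Fin 4 → Summand) a) := by
  have h : (⨆ a, D.summand ((![.k₁, .k₂, .k₃, .m₁] : Fin 4 → Summand) a)) =
      D.k.toSubmodule ⊔ D.summand .m₁ := by
    rw [hD.k_eq, ← Finset.sup_univ_eq_iSup]
    simp [Fin.univ_succ, summand, sup_assoc]
  rw [h]
  refine le_antisymm (fun x hx => ?_) (sup_le (fun x hx => hx.1) inf_le_left)
  have hx' : D.θ x = x := hx
  rw [show x = (2⁻¹ : ℝ) • (x + D.τ x) + (2⁻¹ : ℝ) • (x - D.τ x) by module]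
  refine Submodule.add_mem_sup (Submodule.smul_mem _ _ ⟨?_, ?_⟩) (Submodule.smul_mem _ _ ⟨?_, ?_⟩)
  · change D.θ (x + D.τ x) = x + D.τ x
    rw [map_add, hD.comm, hx']
  · change D.τ (x + D.τ x) = x + D.τ x
    rw [map_add, hD.τ_invol, add_comm]
  · change D.θ (x - D.τ x) = x - D.τ x
    rw [map_sub, hD.comm, hx']
  · change D.τ (x - D.τ x) = -(x - D.τ x)
    rw [map_sub, hD.τ_invol, neg_sub]

lemma top_eq_iSup : (⊤ : LieSubalgebra ℝ g).toSubmodule =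
    ⨆ a, D.summand ((![.k₁, .k₂, .k₃, .m₁, .m₂, .m₃] : Fin 6 → Summand) a) := by
  have h : (⨆ a, D.summand ((![.k₁, .k₂, .k₃, .m₁, .m₂, .m₃] : Fin 6 → Summand) a)) =
      (fixedSubalgebra D.θ).toSubmodule ⊔ (D.summand .m₂ ⊔ D.summand .m₃) := by
    rw [hD.fixedSubalgebra_θ_eq_iSup, ← Finset.sup_univ_eq_iSup, ← Finset.sup_univ_eq_iSup]
    simp [Fin.univ_succ, summand, sup_assoc]
  rw [h]
  refine le_antisymm (fun x _ => ?_) le_top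
  rw [show x = (2⁻¹ : ℝ) • (x + D.θ x) +
    ((4⁻¹ : ℝ) • (x - D.θ x + D.τ (x - D.θ x)) + (4⁻¹ : ℝ) • (x - D.θ x - D.τ (x - D.θ x))) by module]
  have hθ : D.θ (x - D.θ x) = -(x - D.θ x) := by rw [map_sub, hD.θ_invol, neg_sub]
  generalize x - D.θ x = y at hθ
  refine Submodule.add_mem_sup (Submodule.smul_mem _ _ ?_) (Submodule.add_mem_sup
    (Submodule.smul_mem _ _ ⟨?_, ?_⟩) (Submodule.smul_mem _ _ ⟨?_, ?_⟩))
  · change D.θ (x + D.θ x) = x + D.θ x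
    rw [map_add, hD.θ_invol, add_comm]
  · change D.θ (y + D.τ y) = -(y + D.τ y)
    rw [map_add, hD.comm, hθ, map_neg, neg_add]
  · change D.τ (y + D.τ y) = y + D.τ y
    rw [map_add, hD.τ_invol, add_comm]
  · change D.θ (y - D.τ y) = -(y - D.τ y)
    rw [map_sub, hD.comm, hθ, map_neg, neg_sub, neg_sub_neg]
  · change D.τ (y - D.τ y) = -(y - D.τ y)
    rw [map_sub, hD.τ_invol, neg_sub]

end IsWallachTriple

namespace AdaptedBasis

variable (E : D.AdaptedBasis)

lemma coeff_self_left (i j : Summand) : E.coeff j i j = E.coeff i j j := E.coeff_swap j i j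

lemma coeff_self_self (i j : Summand) : E.coeff j j i = E.coeff i j j := (E.coeff_rotate i j j).symm

lemma coeff_nonneg (i j k : Summand) : 0 ≤ E.coeff i j k :=
  Finset.sum_nonneg fun _ _ => Finset.sum_nonneg fun _ _ => Finset.sum_nonneg fun _ _ => sq_nonneg _

variable (hD : D.IsWallachTriple)

include hD

/-- `(155) = 0`, since `𝔨₁` is an ideal of `𝔤^τ`, which contains `𝔪₂`. -/
lemma coeff_k₁_m₂_m₂ : E.coeff .k₁ .m₂ .m₂ = 0 := by
  refine E.coeff_eq_zero fun x hx y hy z hz => hD.orthogonal .k₁ .m₂ (by decide) _ ?_ z hz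
  rw [← lie_skew]
  exact (D.summand .k₁).neg_mem (hD.ideal_k₁_fixed.2 y hy.2 x hx)

/-- The equations which express that `B` is minus the trace form of the adjoint representation. -/
lemma sum_coeff_top :
    (E.coeff .k₁ .k₁ .k₁ + E.coeff .k₁ .m₁ .m₁ + E.coeff .k₁ .m₃ .m₃ =
      finrank ℝ (D.summand .k₁) ∧
    E.coeff .k₂ .k₂ .k₂ + E.coeff .k₂ .m₁ .m₁ + E.coeff .k₂ .m₂ .m₂ + E.coeff .k₂ .m₃ .m₃ =
      finrank ℝ (D.summand .k₂) ∧
    E.coeff .k₃ .k₃ .k₃ + E.coeff .k₃ .m₁ .m₁ + E.coeff .k₃ .m₂ .m₂ + E.coeff .k₃ .m₃ .m₃ =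
      finrank ℝ (D.summand .k₃)) ∧
    2 * (E.coeff .k₁ .m₁ .m₁ + E.coeff .k₂ .m₁ .m₁ + E.coeff .k₃ .m₁ .m₁ + E.coeff .m₁ .m₂ .m₃) =
      finrank ℝ (D.summand .m₁) ∧
    2 * (E.coeff .k₂ .m₂ .m₂ + E.coeff .k₃ .m₂ .m₂ + E.coeff .m₁ .m₂ .m₃) =
      finrank ℝ (D.summand .m₂) ∧
    2 * (E.coeff .k₁ .m₃ .m₃ + E.coeff .k₂ .m₃ .m₃ + E.coeff .k₃ .m₃ .m₃ + E.coeff .m₁ .m₂ .m₃) =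
      finrank ℝ (D.summand .m₃) := by
  have hs : Function.Injective (![.k₁, .k₂, .k₃, .m₁, .m₂, .m₃] : Fin 6 → Summand) := by decide
  have h := sum_coeff_eq_mul_finrank hD E hs hD.top_eq_iSup (c := 1) fun x y =>
    (LieAlgebra.killingForm_of_equiv_apply LieSubalgebra.topEquiv x y).symm.trans (one_mul _).symm
  have e₁ : E.coeff .m₁ .m₃ .m₂ = E.coeff .m₁ .m₂ .m₃ := by
    rw [E.coeff_swap, E.coeff_rotate]
  have e₂ : E.coeff .m₂ .m₁ .m₃ = E.coeff .m₁ .m₂ .m₃ := E.coeff_swap _ _ _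
  have e₃ : E.coeff .m₂ .m₃ .m₁ = E.coeff .m₁ .m₂ .m₃ :=
    (E.coeff_rotate .m₁ .m₂ .m₃).symm
  have e₄ : E.coeff .m₃ .m₁ .m₂ = E.coeff .m₁ .m₂ .m₃ :=
    E.coeff_rotate .m₃ .m₁ .m₂
  have e₅ : E.coeff .m₃ .m₂ .m₁ = E.coeff .m₁ .m₂ .m₃ := by
    rw [E.coeff_swap, e₃]
  have h₀ := h .k₁ (by decide)
  have h₁ := h .k₂ (by decide)
  have h₂ := h .k₃ (by decide)
  have h₃ := h .m₁ (by decide)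
  have h₄ := h .m₂ (by decide)
  have h₅ := h .m₃ (by decide)
  simp (disch := decide) only [Fin.sum_univ_succ, Fin.sum_univ_zero,
    Matrix.cons_val_zero, Matrix.cons_val_succ, Matrix.cons_val_fin_one,
    E.coeff_eq_zero_of_sign hD, E.coeff_eq_zero_of_ne hD,
    e₁, e₂, e₃, e₄, e₅, E.coeff_self_left .k₁, E.coeff_self_left .k₂, E.coeff_self_left .k₃,
    E.coeff_self_self .k₁, E.coeff_self_self .k₂, E.coeff_self_self .k₃, E.coeff_k₁_m₂_m₂ hD,
    zero_add, add_zero, one_mul] at h₀ h₁ h₂ h₃ h₄ h₅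
  refine ⟨⟨?_, ?_, ?_⟩, ?_, ?_, ?_⟩ <;> linarith

/-- The equations which express that the Killing form of `𝔤^θ` is proportional to the one of `g`. -/
lemma sum_coeff_fixedSubalgebra {c : ℝ} (hc : ∀ x y : fixedSubalgebra D.θ,
      killingForm ℝ (fixedSubalgebra D.θ) x y = c * killingForm ℝ g x y) :
    (E.coeff .k₁ .k₁ .k₁ + E.coeff .k₁ .m₁ .m₁ = c * finrank ℝ (D.summand .k₁) ∧
    E.coeff .k₂ .k₂ .k₂ + E.coeff .k₂ .m₁ .m₁ = c * finrank ℝ (D.summand .k₂) ∧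
    E.coeff .k₃ .k₃ .k₃ + E.coeff .k₃ .m₁ .m₁ = c * finrank ℝ (D.summand .k₃)) ∧
    2 * (E.coeff .k₁ .m₁ .m₁ + E.coeff .k₂ .m₁ .m₁ + E.coeff .k₃ .m₁ .m₁) =
      c * finrank ℝ (D.summand .m₁) := by
  have hs : Function.Injective (![.k₁, .k₂, .k₃, .m₁] : Fin 4 → Summand) := by decide
  have h := sum_coeff_eq_mul_finrank hD E hs hD.fixedSubalgebra_θ_eq_iSup hc
  have h₀ := h .k₁ (by decide)
  have h₁ := h .k₂ (by decide)
  have h₂ := h .k₃ (by decide)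
  have h₃ := h .m₁ (by decide)
  simp (disch := decide) only [Fin.sum_univ_succ, Fin.sum_univ_zero,
    Matrix.cons_val_zero, Matrix.cons_val_succ, Matrix.cons_val_fin_one,
    E.coeff_eq_zero_of_sign hD, E.coeff_eq_zero_of_ne hD,
    E.coeff_self_left .k₁, E.coeff_self_left .k₂, E.coeff_self_left .k₃,
    E.coeff_self_self .k₁, E.coeff_self_self .k₂, E.coeff_self_self .k₃,
    zero_add, add_zero] at h₀ h₁ h₂ h₃
  refine ⟨⟨h₀, h₁, h₂⟩, ?_⟩
  linarith

/-- The equations which express that the Killing form of `𝔟₂` is proportional to the one of `g`. -/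
lemma sum_coeff_b₂ {c : ℝ} (hc : ∀ x y : D.b₂,
      killingForm ℝ D.b₂ x y = c * killingForm ℝ g x y) :
    (E.coeff .k₂ .k₂ .k₂ + E.coeff .k₂ .m₂ .m₂ = c * finrank ℝ (D.summand .k₂) ∧
    E.coeff .k₃ .k₃ .k₃ + E.coeff .k₃ .m₂ .m₂ = c * finrank ℝ (D.summand .k₃)) ∧
    2 * (E.coeff .k₂ .m₂ .m₂ + E.coeff .k₃ .m₂ .m₂) = c * finrank ℝ (D.summand .m₂) := by
  have hs : Function.Injective (![.k₂, .k₃, .m₂] : Fin 3 → Summand) := by decide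
  have h := sum_coeff_eq_mul_finrank hD E hs hD.b₂_eq_iSup hc
  have h₀ := h .k₂ (by decide)
  have h₁ := h .k₃ (by decide)
  have h₂ := h .m₂ (by decide)
  simp (disch := decide) only [Fin.sum_univ_succ, Fin.sum_univ_zero,
    Matrix.cons_val_zero, Matrix.cons_val_succ, Matrix.cons_val_fin_one,
    E.coeff_eq_zero_of_sign hD, E.coeff_eq_zero_of_ne hD,
    E.coeff_self_left .k₂, E.coeff_self_left .k₃,
    E.coeff_self_self .k₂, E.coeff_self_self .k₃,
    zero_add, add_zero] at h₀ h₁ h₂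
  refine ⟨⟨h₀, h₁⟩, ?_⟩
  linarith

include E in
/-- The dimensions of the summands, in terms of those of `g`, of `𝔤^θ` and of `𝔟₂`. -/
lemma finrank_eqs :
    finrank ℝ (fixedSubalgebra D.θ) = finrank ℝ (D.summand .k₁) + finrank ℝ (D.summand .k₂) +
      finrank ℝ (D.summand .k₃) + finrank ℝ (D.summand .m₁) ∧
    finrank ℝ D.b₂ = finrank ℝ (D.summand .k₂) + finrank ℝ (D.summand .k₃) +
      finrank ℝ (D.summand .m₂) ∧
    finrank ℝ g = finrank ℝ (fixedSubalgebra D.θ) + finrank ℝ (D.summand .m₂) +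
      finrank ℝ (D.summand .m₃) := by
  have h₁ := finrank_eq_sum_of_eq_iSup hD E (by decide) hD.fixedSubalgebra_θ_eq_iSup
  have h₂ := finrank_eq_sum_of_eq_iSup hD E (by decide) hD.b₂_eq_iSup
  have h₃ := finrank_eq_sum_of_eq_iSup hD E (by decide) hD.top_eq_iSup
  rw [LieSubalgebra.top_toSubmodule, finrank_top] at h₃
  have h₄ := h₁.trans (Fin.sum_univ_four _)
  refine ⟨h₄, h₂.trans (Fin.sum_univ_three _), h₃.trans ((Fin.sum_univ_six _).trans ?_)⟩
  exact congrArg (· + finrank ℝ (D.summand .m₂) + finrank ℝ (D.summand .m₃)) h₄.symm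

include E in
/-- The Killing form of a compact simple subalgebra spanned by summands is proportional to the
restriction of the Killing form of `g`. -/
lemma exists_killingForm_eq_mul_of_isCompactOfType {n : ℕ} {A : Matrix (Fin n) (Fin n) ℤ}
    (hA : CartanMatrix.IsConnected A) (hn : 0 < n) {h : LieSubalgebra ℝ g} (ht : IsCompactOfType A h)
    (hpos : 0 < finrank ℝ h) {m : ℕ} {s : Fin m → Summand} (hs : Function.Injective s)
    (hh : h.toSubmodule = ⨆ a, D.summand (s a)) :
    ∃ c : ℝ, ∀ x y : h, killingForm ℝ h x y = c * killingForm ℝ g x y := by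
  have := finrank_pos_iff.1 hpos
  obtain ⟨b, -, hb⟩ := exists_basis_of_eq_iSup hD E hs hh
  exact exists_killingForm_eq_mul hb (ht.ideal_eq_bot_or_eq_top hn hA)

/-- If the eigenvalue of the Casimir operator of `𝔨₂` on `𝔪₃` were positive, then it would be so large
that `(266) ≥ dim 𝔪₃ / 8 · (222)`. -/
lemma coeff_k₂_m₃_m₃_eq_zero_or_le (h₃ : finrank ℝ (D.summand .k₂) = 3) :
    E.coeff .k₂ .m₃ .m₃ = 0 ∨
      finrank ℝ (D.summand .m₃) / 8 * E.coeff .k₂ .k₂ .k₂ ≤ E.coeff .k₂ .m₃ .m₃ :=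
  E.coeff_eq_zero_or_le h₃ hD.ideal_k₂.2 hD.ideal_k₂.1 hD.irreducible_m₃

end AdaptedBasis

end WallachData

theorem lemma3p3 {g : Type*} [LieRing g] [LieAlgebra ℝ g] [FiniteDimensional ℝ g]
    (D : WallachData g) (E : D.AdaptedBasis) :
    (D.IsF4II →
      (E.coeff .k₁ .k₁ .k₁ = 2 / 3 ∧ E.coeff .k₂ .k₂ .k₂ = 2 / 3 ∧
        E.coeff .k₃ .k₃ .k₃ = 10 / 3 ∧
        E.coeff .k₁ .m₁ .m₁ = 5 / 3 ∧ E.coeff .k₂ .m₁ .m₁ = 5 / 3 ∧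
        E.coeff .k₁ .m₂ .m₂ = 0 ∧ E.coeff .k₂ .m₃ .m₃ = 0 ∧
        E.coeff .k₁ .m₃ .m₃ = 2 / 3 ∧ E.coeff .k₂ .m₂ .m₂ = 2 / 3 ∧
        E.coeff .k₃ .m₂ .m₂ = 10 / 9 ∧ E.coeff .k₃ .m₃ .m₃ = 10 / 9 ∧
        E.coeff .k₃ .m₁ .m₁ = 40 / 9 ∧ E.coeff .m₁ .m₂ .m₃ = 20 / 9) ∧
      ∀ i j k : Summand, ({i, j, k} : Multiset Summand) ∉ listedTriples → E.coeff i j k = 0) ∧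
    (D.IsE8I →
      (E.coeff .k₁ .k₁ .k₁ = 1 / 5 ∧ E.coeff .k₂ .k₂ .k₂ = 1 / 5 ∧
        E.coeff .k₃ .k₃ .k₃ = 22 ∧
        E.coeff .k₁ .m₁ .m₁ = 6 / 5 ∧ E.coeff .k₂ .m₁ .m₁ = 6 / 5 ∧
        E.coeff .k₁ .m₂ .m₂ = 0 ∧ E.coeff .k₂ .m₃ .m₃ = 0 ∧
        E.coeff .k₁ .m₃ .m₃ = 8 / 5 ∧ E.coeff .k₂ .m₂ .m₂ = 8 / 5 ∧
        E.coeff .k₃ .m₁ .m₁ = 44 / 5 ∧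
        E.coeff .k₃ .m₂ .m₂ = 88 / 5 ∧ E.coeff .k₃ .m₃ .m₃ = 88 / 5 ∧
        E.coeff .m₁ .m₂ .m₃ = 64 / 5) ∧
      ∀ i j k : Summand, ({i, j, k} : Multiset Summand) ∉ listedTriples → E.coeff i j k = 0) := by
  refine ⟨fun h => ⟨?_, E.coeff_eq_zero_of_notMem h.toIsWallachTriple⟩,
    fun h => ⟨?_, E.coeff_eq_zero_of_notMem h.toIsWallachTriple⟩⟩
  · have hD := h.toIsWallachTriple
    have n₁ : Module.finrank ℝ (D.summand .k₁) = 3 := h.type_k₁.finrank_A_one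
    have n₂ : Module.finrank ℝ (D.summand .k₂) = 3 := h.type_k₂.finrank_A_one
    have n₃ : Module.finrank ℝ (D.summand .k₃) = 10 := h.type_k₃.finrank_C_two
    have nθ := h.type_b.finrank_B_four
    have nb := h.type_b₂.finrank_C_three
    obtain ⟨d₁, d₂, d₃⟩ := E.finrank_eqs hD
    rw [h.type_g.finrank_F_four] at d₃
    have n₄ : Module.finrank ℝ (D.summand .m₁) = 20 := by omega
    have n₅ : Module.finrank ℝ (D.summand .m₂) = 8 := by omega
    have n₆ : Module.finrank ℝ (D.summand .m₃) = 8 := by omega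
    obtain ⟨cθ, hθ⟩ := E.exists_killingForm_eq_mul_of_isCompactOfType hD
      CartanMatrix.isConnected_B_four (by norm_num) h.type_b (by omega) (by decide)
      hD.fixedSubalgebra_θ_eq_iSup
    obtain ⟨cb, hb⟩ := E.exists_killingForm_eq_mul_of_isCompactOfType hD
      CartanMatrix.isConnected_C_three (by norm_num) h.type_b₂ (by omega) (by decide)
      hD.b₂_eq_iSup
    have e₁ := E.sum_coeff_top hD
    have e₂ := E.sum_coeff_fixedSubalgebra hD hθ
    have e₃ := E.sum_coeff_b₂ hD hb
    have e₄ := E.coeff_k₂_m₃_m₃_eq_zero_or_le hD n₂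
    have e₅ := E.coeff_k₁_m₂_m₂ hD
    simp only [n₁, n₂, n₃, n₄, n₅, n₆, Nat.cast_ofNat] at e₁ e₂ e₃ e₄
    obtain ⟨⟨_, _, _⟩, _, _, _⟩ := e₁
    obtain ⟨⟨_, _, _⟩, _⟩ := e₂
    obtain ⟨⟨_, _⟩, _⟩ := e₃
    -- the equations give `(266) = (222) - 2 / 3`, while `dim 𝔪₃ / 8 = 1`
    have e₄ : E.coeff .k₂ .m₃ .m₃ = 0 := e₄.resolve_right fun _ => by linarith
    refine ⟨?_, ?_, ?_, ?_, ?_, ?_, ?_, ?_, ?_, ?_, ?_, ?_, ?_⟩ <;> linarith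
  · have hD := h.toIsWallachTriple
    have n₁ : Module.finrank ℝ (D.summand .k₁) = 3 := h.type_k₁.finrank_A_one
    have n₂ : Module.finrank ℝ (D.summand .k₂) = 3 := h.type_k₂.finrank_A_one
    have n₃ : Module.finrank ℝ (D.summand .k₃) = 66 := h.type_k₃.finrank_D_six
    have nθ := h.type_b.finrank_D_eight
    have nb := h.type_b₂.finrank_E_seven
    obtain ⟨d₁, d₂, d₃⟩ := E.finrank_eqs hD
    rw [h.type_g.finrank_E_eight] at d₃
    have n₄ : Module.finrank ℝ (D.summand .m₁) = 48 := by omega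
    have n₅ : Module.finrank ℝ (D.summand .m₂) = 64 := by omega
    have n₆ : Module.finrank ℝ (D.summand .m₃) = 64 := by omega
    obtain ⟨cθ, hθ⟩ := E.exists_killingForm_eq_mul_of_isCompactOfType hD
      CartanMatrix.isConnected_D_eight (by norm_num) h.type_b (by omega) (by decide)
      hD.fixedSubalgebra_θ_eq_iSup
    obtain ⟨cb, hb⟩ := E.exists_killingForm_eq_mul_of_isCompactOfType hD
      CartanMatrix.isConnected_E_seven (by norm_num) h.type_b₂ (by omega) (by decide)
      hD.b₂_eq_iSup
    have e₁ := E.sum_coeff_top hD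
    have e₂ := E.sum_coeff_fixedSubalgebra hD hθ
    have e₃ := E.sum_coeff_b₂ hD hb
    have e₄ := E.coeff_k₂_m₃_m₃_eq_zero_or_le hD n₂
    have e₅ := E.coeff_nonneg .k₂ .k₂ .k₂
    have e₆ := E.coeff_k₁_m₂_m₂ hD
    simp only [n₁, n₂, n₃, n₄, n₅, n₆, Nat.cast_ofNat] at e₁ e₂ e₃ e₄
    obtain ⟨⟨_, _, _⟩, _, _, _⟩ := e₁
    obtain ⟨⟨_, _, _⟩, _⟩ := e₂
    obtain ⟨⟨_, _⟩, _⟩ := e₃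
    -- the equations give `(266) = (222) - 1 / 5`, while `dim 𝔪₃ / 8 = 8` and `0 ≤ (222)`
    have e₄ : E.coeff .k₂ .m₃ .m₃ = 0 := e₄.resolve_right fun _ => by linarith
    refine ⟨?_, ?_, ?_, ?_, ?_, ?_, ?_, ?_, ?_, ?_, ?_, ?_, ?_⟩ <;> linarith
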